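/- Let $X$ be a locally compact Hausdorff space with countable base. A boundary kernel for an open set $U\subset X$ is a kernel $T$ on $X$ such that $T(x,X\setminus\partial U)=0$ for $x\in U$ and $T(x,\cdot)=\varepsilon_x$ (the Dirac measure) for $x\notin U$. Let $\mathcal V$ be a base of the topology of $X$ consisting of relatively compact open sets and, for each $V\in\mathcal V$, let $H_V$ be a boundary kernel for $V$; write $H_Vf(x)=\int f\,dH_V(x,\cdot)$. For open $U$ let $\mathcal V(U)=\{W\in\mathcal V:\overline W\subset U\}$. A local choice in $U$ is a map assigning to each $x\in U$ a fundamental system $\mathcal W(x)\subset\mathcal V(U)$ of neighborhoods of $x$. A lower semicontinuous $u:U\to(-\infty,\infty]$ is $\mathcal W$-hyperharmonic on $U$ if $H_Wu(x)\le u(x)$ for all $x\in U$ and $W\in\mathcal W(x)$; it is hyperharmonic on $U$ if this holds for all $W\in\mathcal V(U)$ and $x\in W$. A continuous $h:U\to\mathbb R$ is harmonic on $U$ if $H_Vh=h$ for all $V\in\mathcal V(U)$. A hyperharmonic $s$ on $U$ is superharmonic if $H_Vs$ is locally bounded on $V$ for every $V\in\mathcal V(U)$. An open set $U$ is a $\mathcal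 P$-set if the positive (that is, $\ge 0$) hyperharmonic functions on $U$ separate the points of $U$. Suppose that $(H_V)_{V\in\mathcal V}$ is a normal Bauer family of harmonic boundary kernels, that is, for every $V\in\mathcal V$: $(H_1)$ $H_WH_V=H_V$ for all $W\in\mathcal V$ with $W\subset V$; $(H_2)$ $H_Vf$ is continuous on $X$ for every continuous $f:X\to\mathbb R$, and $H_V1=1$; $(H_3)$ there is a local choice $\mathcal W$ in $V$ such that the positive $\mathcal W$-hyperharmonic functions on $V$ separate the points of $V$; $(H_4)$ $H_Vf$ is continuous on $V$ for every bounded Borel function $f$ on $X$. Suppose also that the family is elliptic: every harmonic function $h\ge0$ on a connected open set $U$ is identically zero or strictly positive on $U$. A compact $K\subset X$ contained in a $\mathcal P$-set is stable if for every $z\in\partial K$ there are an open neighborhood $N$ of $z$ and a strictly positive superharmonic function $s$ on $N\setminus K$ with $\lim_{x\to z}s(x)=0$. A compact $K\neq\emptyset$ is strongly stable if there are a $\mathcal P$-set $W'\supset K$ and a strictly positive harmonic function $h$ on $W'\setminus K$ with $\lim_{x\to z}h(x)=0$ for every $z\in\partial K$. **Proposition.** Let $K\neq\emptyset$ be a stable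 compact contained in a $\mathcal P$-set $W$. Then $K$ is strongly stable if and only if $K$ has at most finitely many holes, that is, there are only finitely many connected components $V$ of $W\setminus K$ which are relatively compact in $W$ (that is, $\overline V$ is compact and contained in $W$). Moreover, for a connected component $V$ of $W\setminus K$, being relatively compact in $W$ is equivalent to having compact closure in $X$ with $\partial V\subset K$. -/

import Mathlib

open Set Filter Topology MeasureTheory ProbabilityTheory

namespace Bauer

/-- The integral of an extended real valued function, as the integral of the positive part minus
the integral of the negative part. It is used only for functions which are bounded below almost
everywhere, and for probability measures, so the negative part always has a finite integral. -/
noncomputable def eintegral {X : Type*} [MeasurableSpace X] (μ : Measure X) (u : X → EReal) :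
    EReal :=
  ((∫⁻ x, (u x).toENNReal ∂μ : ENNReal) : EReal) - ((∫⁻ x, (-u x).toENNReal ∂μ : ENNReal) : EReal)

section Families

variable {X : Type*} [TopologicalSpace X] [MeasurableSpace X]

/-- `T` is a boundary kernel for `U`: for `x ∈ U` the measure `T x` does not charge the complement
of the boundary of `U`, and for `x ∉ U` it is the Dirac measure at `x`. -/
def IsBoundaryKernel (T : Kernel X X) (U : Set X) : Prop :=
  (∀ x ∈ U, T x (frontier U)ᶜ = 0) ∧ ∀ x, x ∉ U → T x = Measure.dirac x

/-- The members of `𝒱` whose closure is contained in `U`. -/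
def inside (𝒱 : Set (Set X)) (U : Set X) : Set (Set X) :=
  {W | W ∈ 𝒱 ∧ closure W ⊆ U}

/-- `𝒲` is a local choice from `𝒱` in `U`: for each `x ∈ U`, `𝒲 x` is a fundamental system of
neighborhoods of `x` consisting of members of `𝒱` with closure in `U`. -/
def IsLocalChoice (𝒱 : Set (Set X)) (U : Set X) (𝒲 : X → Set (Set X)) : Prop :=
  ∀ x ∈ U, (∀ W ∈ 𝒲 x, W ∈ inside 𝒱 U ∧ x ∈ W) ∧ ∀ N ∈ 𝓝 x, ∃ W ∈ 𝒲 x, W ⊆ N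

/-- `u` is `𝒲`-hyperharmonic on `U`. Functions on `U` are represented by functions on all of `X`;
only the values on `U` matter. -/
def HyperharmonicFor (H : Set X → Kernel X X) (𝒲 : X → Set (Set X)) (U : Set X) (u : X → EReal) :
    Prop :=
  LowerSemicontinuousOn u U ∧ (∀ x ∈ U, u x ≠ ⊥) ∧
    ∀ x ∈ U, ∀ W ∈ 𝒲 x, eintegral (H W x) u ≤ u x

/-- `u` is hyperharmonic on `U`: all members of `𝒱` with closure in `U` are taken into account. -/
def Hyperharmonic (𝒱 : Set (Set X)) (H : Set X → Kernel X X) (U : Set X) (u : X → EReal) : Prop :=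
  HyperharmonicFor H (fun x => {W | W ∈ inside 𝒱 U ∧ x ∈ W}) U u

/-- The functions in `F` which are positive on `U` separate the points of `U`. -/
def PosSeparates (F : Set (X → EReal)) (U : Set X) : Prop :=
  ∀ x ∈ U, ∀ y ∈ U, x ≠ y → ∃ u ∈ F, (∀ z ∈ U, 0 ≤ u z) ∧ u x ≠ u y

/-- `h` is harmonic on `U` (real valued; only the values on `U` matter). -/
def Harmonic (𝒱 : Set (Set X)) (H : Set X → Kernel X X) (U : Set X) (h : X → ℝ) : Prop :=
  ContinuousOn h U ∧ ∀ V ∈ inside 𝒱 U, ∀ x ∈ U, ∫ y, h y ∂(H V x) = h x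

/-- `s` is superharmonic on `U`: it is hyperharmonic on `U` and, for each member `V` of `𝒱` with
closure in `U`, the function `x ↦ ∫ s d(H V x)` is locally bounded on `V`. -/
def Superharmonic (𝒱 : Set (Set X)) (H : Set X → Kernel X X) (U : Set X) (s : X → EReal) : Prop :=
  Hyperharmonic 𝒱 H U s ∧
    ∀ V ∈ inside 𝒱 U, ∀ x ∈ V, ∃ M : ℝ, ∀ᶠ y in 𝓝[V] x,
      ((-M : ℝ) : EReal) ≤ eintegral (H V y) s ∧ eintegral (H V y) s ≤ (M : EReal)

/-- `(H V)`, `V ∈ 𝒱`, is a normal Bauer family of harmonic boundary kernels: `𝒱` is a base of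
relatively compact open sets and each `H V`, `V ∈ 𝒱`, is a boundary kernel for `V`, such that
`H1` - `H4` hold. The values `H V` for `V ∉ 𝒱` are irrelevant. -/
structure IsNormalBauerFamily (𝒱 : Set (Set X)) (H : Set X → Kernel X X) : Prop where
  isBasis : TopologicalSpace.IsTopologicalBasis 𝒱
  isCompact_closure : ∀ V ∈ 𝒱, IsCompact (closure V)
  boundary : ∀ V ∈ 𝒱, IsBoundaryKernel (H V) V
  /-- The kernel `H W` followed by `H V`, in the order of Mathlib's composition. -/
  H1 : ∀ V ∈ 𝒱, ∀ W ∈ 𝒱, W ⊆ V → (H V) ∘ₖ (H W) = H V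
  H2_continuous : ∀ V ∈ 𝒱, ∀ f : X → ℝ, Continuous f → Continuous fun x => ∫ y, f y ∂(H V x)
  H2_normal : ∀ V ∈ 𝒱, ∀ x, H V x univ = 1
  H3 : ∀ V ∈ 𝒱, ∃ 𝒲 : X → Set (Set X), IsLocalChoice 𝒱 V 𝒲 ∧
    PosSeparates {u | HyperharmonicFor H 𝒲 V u} V
  H4 : ∀ V ∈ 𝒱, ∀ f : X → ℝ, Measurable f → (∃ C : ℝ, ∀ x, |f x| ≤ C) →
    ContinuousOn (fun x => ∫ y, f y ∂(H V x)) V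

/-- The family is elliptic: each positive harmonic function on a connected open set is identically
zero or strictly positive. -/
def IsElliptic (𝒱 : Set (Set X)) (H : Set X → Kernel X X) : Prop :=
  ∀ U : Set X, IsOpen U → IsConnected U → ∀ h : X → ℝ, Harmonic 𝒱 H U h → (∀ x ∈ U, 0 ≤ h x) →
    (∀ x ∈ U, h x = 0) ∨ ∀ x ∈ U, 0 < h x

/-- `U` is a `𝒫`-set: an open set whose points are separated by the positive hyperharmonic
functions on it. -/
def IsPSet (𝒱 : Set (Set X)) (H : Set X → Kernel X X) (U : Set X) : Prop :=
  IsOpen U ∧ PosSeparates {u | Hyperharmonic 𝒱 H U u} U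

/-- `K` is a stable compact. -/
def IsStable (𝒱 : Set (Set X)) (H : Set X → Kernel X X) (K : Set X) : Prop :=
  IsCompact K ∧ (∃ W, IsPSet 𝒱 H W ∧ K ⊆ W) ∧
    ∀ z ∈ frontier K, ∃ W : Set X, IsOpen W ∧ z ∈ W ∧ ∃ s : X → EReal,
      Superharmonic 𝒱 H (W \ K) s ∧ (∀ x ∈ W \ K, 0 < s x) ∧ Tendsto s (𝓝[W \ K] z) (𝓝 0)

/-- `K` is a strongly stable compact. -/
def IsStronglyStable (𝒱 : Set (Set X)) (H : Set X → Kernel X X) (K : Set X) : Prop :=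
  IsCompact K ∧ K.Nonempty ∧ ∃ W, IsPSet 𝒱 H W ∧ K ⊆ W ∧ ∃ h : X → ℝ,
    Harmonic 𝒱 H (W \ K) h ∧ (∀ x ∈ W \ K, 0 < h x) ∧
      ∀ z ∈ frontier K, Tendsto h (𝓝[W \ K] z) (𝓝 0)

end Families

/-- The connected components of the subset `A` of `X`. -/
def components {X : Type*} [TopologicalSpace X] (A : Set X) : Set (Set X) :=
  {V | ∃ x ∈ A, V = connectedComponentIn A x}

/-- The holes of `K` in `W`: the connected components of `W \ K` which are relatively compact
in `W`. -/
def holes {X : Type*} [TopologicalSpace X] (W K : Set X) : Set (Set X) :=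
  {V | V ∈ components (W \ K) ∧ IsCompact (closure V) ∧ closure V ⊆ W}

end Bauer

/-! Everything rests on a comparison principle: on a relatively compact open subset of a `𝒫`-set, a
strictly positive harmonic function cannot have boundary values zero (`eq_empty_of_harmonic`).
Behind it, the set where a difference attains its positive maximum would be a compact absorbing set,
and a minimal such set would reduce to a point, which no boundary kernel allows
(`eq_empty_of_absorbing`, `le_of_frontier`).

Strongly stable implies finitely many holes: let `h` be the given function on `W' \ K` and `L` a
compact neighborhood of `K` in `W ∩ W'`. A hole missing `∂L` would lie in `L`, and `h` would
contradict the principle there. So each hole meets the compact `∂L ⊆ W \ K`, which meets only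
finitely many components.

Conversely, a component of `W \ K` meeting `L` (now a compact neighborhood of `K` in `W`) either
meets `∂L` or is a hole, so there are finitely many. Let `B` be a union of small open sets, one in
each. The balayage of `B` in `W \ K` is harmonic off `closure B` (`lintegral_balayage`), strictly
positive on these components by the minimum principle that ellipticity yields (`eq_zero_or_pos`),
and tends to zero at `∂K` by stability (`tendsto_balayage`). Components are open because `X` is
locally connected, itself a consequence of the strong Feller property `H4`
(`locallyConnectedSpace`). -/

set_option linter.unusedSectionVars false

namespace Bauer

/-! ### Lower semicontinuous functions and continuous minorants. -/

section Semicontinuity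

variable {X : Type*} [TopologicalSpace X]

theorem exists_continuous_le_of_lt [T2Space X] [LocallyCompactSpace X] {u : X → ENNReal} {z : X}
    (hu : LowerSemicontinuousAt u z) {a : ENNReal} (ha : a < u z) :
    ∃ g : X → ℝ, Continuous g ∧ (∀ x, 0 ≤ g x) ∧ (∀ x, ENNReal.ofReal (g x) ≤ u x) ∧
      a < ENNReal.ofReal (g z) := by
  obtain ⟨b, hab, hbu⟩ := exists_between ha
  have hb : b ≠ ⊤ := hbu.ne_top
  obtain ⟨O, hOu, hO, hzO⟩ := mem_nhds_iff.1 (hu b hbu)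
  obtain ⟨f, hf1, hf0, -, hf⟩ := exists_continuous_one_zero_of_isCompact (isCompact_singleton (x := z))
    hO.isClosed_compl (by simpa using hzO)
  refine ⟨fun x => b.toReal * f x, by fun_prop, fun x => mul_nonneg ENNReal.toReal_nonneg (hf x).1,
    fun x => ?_, ?_⟩
  · by_cases hx : x ∈ O
    · calc ENNReal.ofReal (b.toReal * f x) ≤ ENNReal.ofReal b.toReal :=
            ENNReal.ofReal_le_ofReal (mul_le_of_le_one_right ENNReal.toReal_nonneg (hf x).2)
        _ = b := ENNReal.ofReal_toReal hb
        _ ≤ u x := (hOu hx).le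
    · simp [show f x = 0 from hf0 hx]
  · simpa [show f z = 1 from hf1 rfl, ENNReal.ofReal_toReal hb] using hab

/-- By second countability, `u` is the supremum of an increasing sequence of continuous functions,
so monotone convergence reduces the estimate to continuous integrands, the ones that `H2` controls.
-/
theorem lintegral_le_of_forall_continuous [T2Space X] [LocallyCompactSpace X]
    [SecondCountableTopology X] [MeasurableSpace X] [BorelSpace X] {μ : Measure X}
    {u : X → ENNReal} (hu : LowerSemicontinuous u) {a : ENNReal}
    (h : ∀ g : X → ℝ, Continuous g → (∀ x, 0 ≤ g x) → (∀ x, ENNReal.ofReal (g x) ≤ u x) →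
      ∫⁻ x, ENNReal.ofReal (g x) ∂μ ≤ a) : ∫⁻ x, u x ∂μ ≤ a := by
  let 𝓕 : Set (X → ENNReal) := {f | ∃ g : X → ℝ, Continuous g ∧ (∀ x, 0 ≤ g x) ∧
    (∀ x, ENNReal.ofReal (g x) ≤ u x) ∧ f = fun x => ENNReal.ofReal (g x)}
  have h𝓕 : IsLUB 𝓕 u := by
    constructor
    · rintro _ ⟨g, -, -, hg, rfl⟩
      exact hg
    · intro f hf x
      by_contra! hx
      obtain ⟨g, hg, hg0, hgu, hgx⟩ := exists_continuous_le_of_lt (hu x) hx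
      exact absurd (hf ⟨g, hg, hg0, hgu, rfl⟩ x) (not_le.2 hgx)
  obtain ⟨𝓕', hsub, hcount, hlub⟩ := exists_countable_lowerSemicontinuous_isLUB (𝓕 := 𝓕) (s := u)
    (by
      rintro _ ⟨g, hg, -, -, rfl⟩
      exact (ENNReal.continuous_ofReal.comp hg).lowerSemicontinuous) h𝓕
  -- Adjoining zero makes the countable family nonempty, so that it can be enumerated.
  have h0 : (fun _ => 0 : X → ENNReal) ∈ 𝓕 := ⟨fun _ => 0, by fun_prop, by simp, by simp, by simp⟩
  obtain ⟨f, hf⟩ := (hcount.insert (fun _ => 0 : X → ENNReal)).exists_eq_range (insert_nonempty _ _)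
  have hf𝓕 : ∀ n, f n ∈ 𝓕 := fun n => by
    have : f n ∈ insert (fun _ => 0 : X → ENNReal) 𝓕' := hf ▸ mem_range_self n
    rcases this with h | h
    · exact h ▸ h0
    · exact hsub h
  have hp𝓕 : ∀ n, partialSups f n ∈ 𝓕 := fun n => by
    induction n with
    | zero => simpa using hf𝓕 0
    | succ n ih =>
      rw [partialSups_add_one]
      obtain ⟨g, hg, hg0, hgu, hgf⟩ := ih
      obtain ⟨g', hg', hg0', hgu', hgf'⟩ := hf𝓕 (n + 1)
      refine ⟨fun x => max (g x) (g' x), hg.max hg', fun x => le_max_of_le_left (hg0 x),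
        fun x => ?_, ?_⟩
      · rw [ENNReal.ofReal_max]
        exact max_le (hgu x) (hgu' x)
      · rw [hgf, hgf']
        ext x
        simp [ENNReal.ofReal_max]
  have hsup : ∀ x, u x = ⨆ n, partialSups f n x := fun x => by
    apply le_antisymm
    · have : u ≤ fun x => ⨆ n, partialSups f n x := hlub.2 fun k hk => by
        have : k ∈ range f := hf ▸ mem_insert_of_mem _ hk
        obtain ⟨n, rfl⟩ := this
        exact fun x => (le_partialSups f n x).trans (le_iSup (fun n => partialSups f n x) n)
      exact this x
    · exact iSup_le fun n => h𝓕.1 (hp𝓕 n) x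
  simp_rw [hsup]
  rw [lintegral_iSup]
  · refine iSup_le fun n => ?_
    obtain ⟨g, hg, hg0, hgu, hgf⟩ := hp𝓕 n
    rw [hgf]
    exact h g hg hg0 hgu
  · intro n
    obtain ⟨g, hg, hg0, hgu, hgf⟩ := hp𝓕 n
    rw [hgf]
    exact (ENNReal.continuous_ofReal.comp hg).measurable
  · exact fun m n hmn => (partialSups f).mono hmn

theorem exists_forall_one_le_mul {F : Set X} (hF : IsCompact F) {s : X → ENNReal}
    (hs : LowerSemicontinuousOn s F) (hpos : ∀ x ∈ F, 0 < s x) :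
    ∃ c : ENNReal, c ≠ ⊤ ∧ ∀ x ∈ F, 1 ≤ c * s x := by
  rcases F.eq_empty_or_nonempty with rfl | hne
  · exact ⟨0, by simp, by simp⟩
  obtain ⟨a, ha, hmin⟩ := hs.exists_isMinOn hne hF
  rw [isMinOn_iff] at hmin
  -- The minimum of `s` may be `⊤`; truncation at `1` keeps it invertible.
  have h0 : min (s a) 1 ≠ 0 := (lt_min (hpos a ha) one_pos).ne'
  have htop : min (s a) 1 ≠ ⊤ := ((min_le_right _ _).trans_lt ENNReal.one_lt_top).ne
  refine ⟨(min (s a) 1)⁻¹, by simpa using h0, fun x hx => ?_⟩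
  exact (ENNReal.inv_mul_cancel h0 htop).symm.trans_le
    (mul_le_mul' le_rfl ((min_le_left _ _).trans (hmin x hx)))

theorem aemeasurable_of_lowerSemicontinuousOn [MeasurableSpace X] [BorelSpace X]
    {μ : Measure X} {S : Set X} (hS : MeasurableSet S) (hμ : ∀ᵐ y ∂μ, y ∈ S) {u : X → ENNReal}
    (hu : LowerSemicontinuousOn u S) : AEMeasurable u μ := by
  rw [← Measure.restrict_eq_self_of_ae_mem hμ]
  refine (aemeasurable_restrict_iff_comap_subtype hS).2 ?_
  exact (lowerSemicontinuous_restrict_iff.2 hu).measurable.aemeasurable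

end Semicontinuity

/-! ### Positive hyperharmonic functions as supermean functions with values in `[0, ∞]`. -/

variable {X : Type*} [TopologicalSpace X] [MeasurableSpace X]

/-- `s` is lower semicontinuous on `U` and has the supermean value property with respect to the
sets in `𝒲 x`, `x ∈ U`. -/
def SupermeanOn (H : Set X → Kernel X X) (𝒲 : X → Set (Set X)) (U : Set X) (s : X → ENNReal) :
    Prop :=
  LowerSemicontinuousOn s U ∧ ∀ x ∈ U, ∀ W ∈ 𝒲 x, ∫⁻ y, s y ∂(H W x) ≤ s x

/-- The members of `𝒱` with closure in `U` which contain `x`. -/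
def insideAt (𝒱 : Set (Set X)) (U : Set X) (x : X) : Set (Set X) :=
  {W | W ∈ inside 𝒱 U ∧ x ∈ W}

/-- `𝒢` selects, for each point of `U`, a nonempty family of members of `𝒱` containing the point,
with closure in `U`. -/
def IsSelection (𝒱 : Set (Set X)) (U : Set X) (𝒢 : X → Set (Set X)) : Prop :=
  ∀ x ∈ U, (𝒢 x).Nonempty ∧ 𝒢 x ⊆ insideAt 𝒱 U x

/-- The positive functions with the supermean value property separate the points of `U`. -/
def SupermeanSeparates (H : Set X → Kernel X X) (𝒲 : X → Set (Set X)) (U : Set X) : Prop :=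
  ∀ x ∈ U, ∀ y ∈ U, x ≠ y → ∃ s, SupermeanOn H 𝒲 U s ∧ s x ≠ s y

variable {𝒱 : Set (Set X)} {H : Set X → Kernel X X}

theorem SupermeanOn.mono {𝒲 𝒲' : X → Set (Set X)} {U U' : Set X} {s : X → ENNReal}
    (h : SupermeanOn H 𝒲 U s) (hU : U' ⊆ U) (hW : ∀ x ∈ U', 𝒲' x ⊆ 𝒲 x) :
    SupermeanOn H 𝒲' U' s :=
  ⟨h.1.mono hU, fun x hx W hx' => h.2 x (hU hx) W (hW x hx hx')⟩

theorem SupermeanSeparates.mono {𝒲 𝒲' : X → Set (Set X)} {U U' : Set X}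
    (h : SupermeanSeparates H 𝒲 U) (hU : U' ⊆ U) (hW : ∀ x ∈ U', 𝒲' x ⊆ 𝒲 x) :
    SupermeanSeparates H 𝒲' U' := fun x hx y hy hxy =>
  let ⟨s, hs, hsxy⟩ := h x (hU hx) y (hU hy) hxy
  ⟨s, hs.mono hU hW, hsxy⟩

theorem insideAt_mono {U U' : Set X} (h : U' ⊆ U) (x : X) : insideAt 𝒱 U' x ⊆ insideAt 𝒱 U x :=
  fun _ hW => ⟨⟨hW.1.1, hW.1.2.trans h⟩, hW.2⟩

theorem eintegral_of_nonneg {μ : Measure X} {u : X → EReal} (h : ∀ᵐ y ∂μ, 0 ≤ u y) :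
    eintegral μ u = ((∫⁻ y, (u y).toENNReal ∂μ : ENNReal) : EReal) := by
  have : ∫⁻ x, (-u x).toENNReal ∂μ = 0 := by
    rw [lintegral_congr_ae (g := fun _ => 0)]
    · simp
    · filter_upwards [h] with y hy
      exact EReal.toENNReal_of_nonpos (EReal.neg_le_zero.2 hy)
  simp [eintegral, this]

namespace IsNormalBauerFamily

theorem isOpen (hH : IsNormalBauerFamily 𝒱 H) {V : Set X} (hV : V ∈ 𝒱) : IsOpen V :=
  hH.isBasis.isOpen hV

theorem isProbabilityMeasure (hH : IsNormalBauerFamily 𝒱 H) {V : Set X} (hV : V ∈ 𝒱) (x : X) :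
    IsProbabilityMeasure (H V x) :=
  ⟨hH.H2_normal V hV x⟩

theorem ae_mem_frontier (hH : IsNormalBauerFamily 𝒱 H) {V : Set X} (hV : V ∈ 𝒱) {x : X}
    (hx : x ∈ V) : ∀ᵐ y ∂(H V x), y ∈ frontier V :=
  (hH.boundary V hV).1 x hx

theorem ae_mem_of_mem_insideAt (hH : IsNormalBauerFamily 𝒱 H) {U W : Set X} {x : X}
    (hW : W ∈ insideAt 𝒱 U x) : ∀ᵐ y ∂(H W x), y ∈ U := by
  filter_upwards [hH.ae_mem_frontier hW.1.1 hW.2] with y hy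
  exact hW.1.2 (frontier_subset_closure hy)

theorem exists_mem_insideAt [T2Space X] [LocallyCompactSpace X] (hH : IsNormalBauerFamily 𝒱 H)
    {N : Set X} {x : X} (hN : N ∈ 𝓝 x) : (insideAt 𝒱 N x).Nonempty := by
  obtain ⟨C, hC, hCc, hCN⟩ := exists_mem_nhds_isClosed_subset hN
  obtain ⟨W, hW, hxW, hWC⟩ := hH.isBasis.mem_nhds_iff.1 hC
  exact ⟨W, ⟨hW, (closure_minimal hWC hCc).trans hCN⟩, hxW⟩

theorem aemeasurable [BorelSpace X] (hH : IsNormalBauerFamily 𝒱 H) {U W : Set X} {x : X}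
    (hW : W ∈ insideAt 𝒱 U x) {u : X → ENNReal} (hu : LowerSemicontinuousOn u U) :
    AEMeasurable u (H W x) :=
  aemeasurable_of_lowerSemicontinuousOn isClosed_frontier.measurableSet
    (hH.ae_mem_frontier hW.1.1 hW.2) (hu.mono (frontier_subset_closure.trans hW.1.2))

theorem supermeanOn_toENNReal (hH : IsNormalBauerFamily 𝒱 H)
    {𝒲 : X → Set (Set X)} {U : Set X} (h𝒲 : ∀ x ∈ U, 𝒲 x ⊆ insideAt 𝒱 U x) {u : X → EReal}
    (hu : HyperharmonicFor H 𝒲 U u) (h0 : ∀ x ∈ U, 0 ≤ u x) :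
    SupermeanOn H 𝒲 U fun x => (u x).toENNReal := by
  refine ⟨EReal.continuous_toENNReal.comp_lowerSemicontinuousOn hu.1 fun _ _ h =>
    EReal.toENNReal_le_toENNReal h, fun x hx W hW => ?_⟩
  have h := hu.2.2 x hx W hW
  rw [eintegral_of_nonneg] at h
  · rwa [← EReal.coe_ennreal_le_coe_ennreal_iff, EReal.coe_toENNReal (h0 x hx)]
  · filter_upwards [hH.ae_mem_of_mem_insideAt (h𝒲 x hx hW)] with y hy using h0 y hy

theorem supermeanSeparates (hH : IsNormalBauerFamily 𝒱 H)
    {𝒲 : X → Set (Set X)} {U : Set X} (h𝒲 : ∀ x ∈ U, 𝒲 x ⊆ insideAt 𝒱 U x)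
    (hU : PosSeparates {u | HyperharmonicFor H 𝒲 U u} U) : SupermeanSeparates H 𝒲 U := by
  intro x hx y hy hxy
  obtain ⟨u, hu, h0, hne⟩ := hU x hx y hy hxy
  refine ⟨_, hH.supermeanOn_toENNReal h𝒲 hu h0, fun h => hne ?_⟩
  rw [← EReal.coe_toENNReal (h0 x hx), h, EReal.coe_toENNReal (h0 y hy)]

theorem supermeanSeparates_of_isPSet (hH : IsNormalBauerFamily 𝒱 H) {U : Set X}
    (hU : IsPSet 𝒱 H U) : SupermeanSeparates H (insideAt 𝒱 U) U :=
  hH.supermeanSeparates (fun _ _ => Subset.rfl) hU.2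

theorem integrable_of_continuous [T2Space X] [BorelSpace X] [SecondCountableTopology X]
    (hH : IsNormalBauerFamily 𝒱 H) {V : Set X} (hV : V ∈ 𝒱) (x : X) {g : X → ℝ}
    (hg : Continuous g) : Integrable g (H V x) := by
  have := hH.isProbabilityMeasure hV x
  by_cases hx : x ∈ V
  · have hc : IsCompact (frontier V) :=
      (hH.isCompact_closure V hV).of_isClosed_subset isClosed_frontier frontier_subset_closure
    rw [← Measure.restrict_eq_self_of_ae_mem (hH.ae_mem_frontier hV hx)]
    exact hg.continuousOn.integrableOn_compact hc
  · rw [(hH.boundary V hV).2 x hx]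
    exact integrable_dirac (by simp)

theorem lintegral_ofReal [T2Space X] [BorelSpace X] [SecondCountableTopology X]
    (hH : IsNormalBauerFamily 𝒱 H) {V : Set X} (hV : V ∈ 𝒱) (x : X) {g : X → ℝ}
    (hg : Continuous g) (hg0 : ∀ x, 0 ≤ g x) :
    ∫⁻ y, ENNReal.ofReal (g y) ∂(H V x) = ENNReal.ofReal (∫ y, g y ∂(H V x)) :=
  (ofReal_integral_eq_lintegral_ofReal (hH.integrable_of_continuous hV x hg)
    (Eventually.of_forall hg0)).symm

theorem continuous_lintegral_ofReal [T2Space X] [BorelSpace X] [SecondCountableTopology X]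
    (hH : IsNormalBauerFamily 𝒱 H) {V : Set X} (hV : V ∈ 𝒱) {g : X → ℝ}
    (hg : Continuous g) (hg0 : ∀ x, 0 ≤ g x) :
    Continuous fun x => ∫⁻ y, ENNReal.ofReal (g y) ∂(H V x) := by
  simp_rw [hH.lintegral_ofReal hV _ hg hg0]
  exact ENNReal.continuous_ofReal.comp (hH.H2_continuous V hV g hg)

theorem lintegral_of_notMem [T2Space X] [BorelSpace X] [SecondCountableTopology X]
    (hH : IsNormalBauerFamily 𝒱 H) {V : Set X} (hV : V ∈ 𝒱) {x : X} (hx : x ∉ V)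
    (f : X → ENNReal) : ∫⁻ y, f y ∂(H V x) = f x := by
  rw [(hH.boundary V hV).2 x hx, lintegral_dirac]

theorem lintegral_lintegral (hH : IsNormalBauerFamily 𝒱 H) {V W : Set X} (hV : V ∈ 𝒱) (hW : W ∈ 𝒱)
    (hWV : W ⊆ V) {f : X → ENNReal} (hf : Measurable f) (x : X) :
    ∫⁻ y, ∫⁻ z, f z ∂(H V y) ∂(H W x) = ∫⁻ z, f z ∂(H V x) := by
  conv_rhs => rw [← hH.H1 V hV W hW hWV]
  rw [Kernel.lintegral_comp _ _ _ hf]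

theorem continuousOn_lintegral (hH : IsNormalBauerFamily 𝒱 H) {V : Set X}
    (hV : V ∈ 𝒱) {f : X → ENNReal} (hf : Measurable f) (hf1 : ∀ x, f x ≤ 1) :
    ContinuousOn (fun x => ∫⁻ y, f y ∂(H V x)) V := by
  have h1 : ∀ x, f x ≠ ⊤ := fun x => ((hf1 x).trans_lt ENNReal.one_lt_top).ne
  have h := hH.H4 V hV (fun x => (f x).toReal) hf.ennreal_toReal
    ⟨1, fun x => by
      rw [abs_of_nonneg ENNReal.toReal_nonneg]
      exact ENNReal.toReal_le_of_le_ofReal zero_le_one (by simpa using hf1 x)⟩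
  refine (ENNReal.continuous_ofReal.comp_continuousOn h).congr fun x _ => ?_
  have := hH.isProbabilityMeasure hV x
  have hle : ∫⁻ y, f y ∂(H V x) ≤ 1 := by
    calc ∫⁻ y, f y ∂(H V x) ≤ ∫⁻ _, 1 ∂(H V x) := lintegral_mono hf1
      _ = 1 := by simp
  rw [Function.comp_apply, integral_toReal hf.aemeasurable
    (Eventually.of_forall fun x => (h1 x).lt_top), ENNReal.ofReal_toReal]
  exact (hle.trans_lt ENNReal.one_lt_top).ne

end IsNormalBauerFamily

end Bauer

/-! ### Absorbing sets, the comparison principle and locality. -/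

namespace Bauer

variable {X : Type*} [TopologicalSpace X] [T2Space X] [LocallyCompactSpace X]
  [SecondCountableTopology X] [MeasurableSpace X] [BorelSpace X]
  {𝒱 : Set (Set X)} {H : Set X → Kernel X X}

theorem lowerSemicontinuousAt_of_isOpen {X Y : Type*} [TopologicalSpace X] [Preorder Y]
    {s : X → Y} {U : Set X} (hs : LowerSemicontinuousOn s U) (hU : IsOpen U) {x : X} (hx : x ∈ U) :
    LowerSemicontinuousAt s x := fun a ha => by
  have := hs x hx a ha
  rwa [hU.nhdsWithin_eq hx] at this

/-- By the Lindelöf property, countably many of the open complements already cover their union. -/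
theorem measure_compl_sInter_eq_zero {μ : Measure X} {c : Set (Set X)}
    (hc : ∀ A ∈ c, IsClosed A) (h : ∀ A ∈ c, μ Aᶜ = 0) : μ (⋂₀ c)ᶜ = 0 := by
  obtain ⟨T, hT, hTc, hTU⟩ := TopologicalSpace.isOpen_sUnion_countable (compl '' c)
    (by rintro _ ⟨A, hA, rfl⟩; exact (hc A hA).isOpen_compl)
  rw [compl_sInter, ← hTU, measure_sUnion_null_iff hT]
  intro B hB
  obtain ⟨A, hA, rfl⟩ := hTc hB
  exact h A hA

namespace IsNormalBauerFamily

/-- There are no nonempty compact absorbing sets where positive supermean functions separate. -/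
theorem eq_empty_of_absorbing (hH : IsNormalBauerFamily 𝒱 H) {G : Set X} {𝒢 : X → Set (Set X)}
    (h𝒢 : IsSelection 𝒱 G 𝒢) (hsep : SupermeanSeparates H 𝒢 G) {M : Set X} (hM : IsCompact M)
    (hMG : M ⊆ G) (habs : ∀ x ∈ M, ∀ W ∈ 𝒢 x, H W x Mᶜ = 0) : M = ∅ := by
  by_contra hne
  let S : Set (Set X) := {A | A ⊆ M ∧ IsClosed A ∧ A.Nonempty ∧
    ∀ x ∈ A, ∀ W ∈ 𝒢 x, H W x Aᶜ = 0}
  obtain ⟨A, hAM, hA⟩ := zorn_superset_nonempty S (by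
    intro c hcS hchain hcne
    refine ⟨⋂₀ c, ⟨?_, isClosed_sInter fun A hA => (hcS hA).2.1, ?_, ?_⟩,
      fun s hs => sInter_subset_of_mem hs⟩
    · obtain ⟨A, hA⟩ := hcne
      exact (sInter_subset_of_mem hA).trans (hcS hA).1
    · have := hcne.to_subtype
      rw [sInter_eq_iInter]
      refine IsCompact.nonempty_iInter_of_directed_nonempty_isCompact_isClosed _ ?_
        (fun A => (hcS A.2).2.2.1) (fun A => hM.of_isClosed_subset (hcS A.2).2.1 (hcS A.2).1)
        fun A => (hcS A.2).2.1
      intro A B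
      rcases hchain.total A.2 B.2 with h | h
      · exact ⟨A, Subset.rfl, h⟩
      · exact ⟨B, h, Subset.rfl⟩
    · intro x hx W hW
      exact measure_compl_sInter_eq_zero (fun A hA => (hcS hA).2.1)
        fun A hA => (hcS hA).2.2.2 x (hx A hA) W hW) M
    ⟨Subset.rfl, hM.isClosed, nonempty_iff_ne_empty.2 hne, habs⟩
  obtain ⟨⟨-, hAc, hAne, hAabs⟩, hmin⟩ := hA
  have hAG := hAM.trans hMG
  have hAcomp := hM.of_isClosed_subset hAc hAM
  -- The subset of `A` where `s` is minimal is again absorbing: at its points the average of `s`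
  -- does not exceed the minimum, so `s` is minimal almost everywhere. By minimality of `A`, this
  -- subset is all of `A`.
  have hconst : ∀ s, SupermeanOn H 𝒢 G s → ∀ x ∈ A, ∀ y ∈ A, s x ≤ s y := by
    intro s hs x hx y hy
    have hsA : LowerSemicontinuousOn s A := hs.1.mono hAG
    obtain ⟨a, ha, hmina⟩ := hsA.exists_isMinOn hAne hAcomp
    rw [isMinOn_iff] at hmina
    have hcl : IsClosed (A ∩ s ⁻¹' Iic (s a)) :=
      (hsA.isCompact_inter_preimage_Iic hAcomp _).isClosed
    have hmem : A ∩ s ⁻¹' Iic (s a) ∈ S := by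
      refine ⟨inter_subset_left.trans hAM, hcl, ⟨a, ha, le_refl (s a)⟩, ?_⟩
      rintro z ⟨hzA, hza⟩ W hW
      have hWi := (h𝒢 z (hAG hzA)).2 hW
      have := hH.isProbabilityMeasure hWi.1.1 z
      have hAae : ∀ᵐ y ∂(H W z), y ∈ A := hAabs z hzA W hW
      suffices h : ∀ᵐ y ∂(H W z), s y ≤ s a by
        have : ∀ᵐ y ∂(H W z), y ∈ A ∩ s ⁻¹' Iic (s a) := by
          filter_upwards [hAae, h] with y h1 h2 using ⟨h1, h2⟩
        exact this
      by_cases htop : s a = ⊤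
      · exact Eventually.of_forall fun y => htop ▸ le_top
      have heq := ae_eq_of_ae_le_of_lintegral_le (μ := H W z) (f := fun _ => s a) (g := s)
        (by filter_upwards [hAae] with y hy using hmina y hy) (by simpa using htop)
        (hH.aemeasurable hWi hs.1) (by
          have := hs.2 z (hAG hzA) W hW
          simpa using this.trans hza)
      filter_upwards [heq] with y hy using hy.symm.le
    have := hmin hmem inter_subset_left hx
    exact this.2.trans (hmina y hy)
  obtain ⟨a, ha⟩ := hAne
  have hsub : ∀ y ∈ A, y = a := fun y hy => by
    by_contra hya
    obtain ⟨s, hs, hne⟩ := hsep y (hAG hy) a (hAG ha) hya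
    exact hne ((hconst s hs y hy a ha).antisymm (hconst s hs a ha y hy))
  obtain ⟨W, hW⟩ := (h𝒢 a (hAG ha)).1
  have hWi := (h𝒢 a (hAG ha)).2 hW
  have := hH.isProbabilityMeasure hWi.1.1 a
  -- `H W a` would be carried both by `A = {a}` and by the boundary of `W`, which does not contain
  -- `a`.
  have hfalse : ∀ᵐ y ∂(H W a), False := by
    have h1 : ∀ᵐ y ∂(H W a), y ∈ A := hAabs a ha W hW
    filter_upwards [h1, hH.ae_mem_frontier hWi.1.1 hWi.2] with y h1 h2
    rw [(hH.isOpen hWi.1.1).frontier_eq] at h2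
    exact h2.2 (hsub y h1 ▸ hWi.2)
  rw [eventually_false_iff_eq_bot, ae_eq_bot] at hfalse
  exact IsProbabilityMeasure.ne_zero _ hfalse

/-- The comparison principle: on a relatively compact open set where the positive supermean
functions separate, a supermean function dominates a submean function if it does so at the
boundary. -/
theorem le_of_frontier (hH : IsNormalBauerFamily 𝒱 H) {G : Set X} (hG : IsOpen G)
    (hGc : IsCompact (closure G)) {𝒢 : X → Set (Set X)} (h𝒢 : IsSelection 𝒱 G 𝒢)
    (hsep : SupermeanSeparates H 𝒢 G) {w : X → ENNReal} (hw : SupermeanOn H 𝒢 G w)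
    {f : X → ENNReal} (hf : ContinuousOn f G) (hf_top : ∀ x ∈ G, f x ≠ ⊤)
    (hf_sub : ∀ x ∈ G, ∀ W ∈ 𝒢 x, f x ≤ ∫⁻ y, f y ∂(H W x))
    (hb : ∀ z ∈ frontier G, ∀ ε : ENNReal, 0 < ε → ∀ᶠ x in 𝓝[G] z, f x ≤ w x + ε) :
    ∀ x ∈ G, f x ≤ w x := by
  by_contra! hcon
  obtain ⟨x₀, hx₀, hlt⟩ := hcon
  -- Truncated subtraction gives the positive part of `f - w`; by the boundary condition its
  -- extension by zero is upper semicontinuous on `closure G`, so it attains its maximum.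
  let d : X → ENNReal := G.indicator fun x => f x - w x
  have hdG : ∀ x ∈ G, d x = f x - w x := fun x hx => indicator_of_mem hx _
  have husc : UpperSemicontinuousOn d (closure G) := by
    intro x hx b hb'
    by_cases hxG : x ∈ G
    · rw [hdG x hxG] at hb'
      obtain ⟨c, hdc, hcb⟩ := exists_between hb'
      have hfc : f x < w x + c := by
        by_cases hwx : w x = ⊤
        · simpa [hwx] using (hf_top x hxG).lt_top
        · calc f x ≤ (f x - w x) + w x := le_tsub_add
            _ < c + w x := ENNReal.add_lt_add_right hwx hdc
            _ = w x + c := add_comm _ _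
      obtain ⟨t, hft, htw⟩ := exists_between hfc
      have hwc : LowerSemicontinuousAt (fun y => w y + c) x :=
        (continuous_add_const c).continuousAt.comp_lowerSemicontinuousAt
          (lowerSemicontinuousAt_of_isOpen hw.1 hG hxG) fun _ _ h => add_le_add_left h c
      refine nhdsWithin_le_nhds ?_
      filter_upwards [hwc t htw, (hf.continuousAt (hG.mem_nhds hxG)).eventually_lt_const hft,
        hG.mem_nhds hxG] with y h1 h2 h3
      rw [hdG y h3]
      exact (tsub_le_iff_left.2 (h2.trans h1).le).trans_lt hcb
    · have hxf : x ∈ frontier G := by rw [hG.frontier_eq]; exact ⟨hx, hxG⟩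
      obtain ⟨ε, hε, hεb⟩ := exists_between ((zero_le (a := d x)).trans_lt hb')
      refine nhdsWithin_le_nhds ?_
      filter_upwards [eventually_nhdsWithin_iff.1 (hb x hxf ε hε)] with y hy
      by_cases hyG : y ∈ G
      · rw [hdG y hyG]
        exact (tsub_le_iff_left.2 (hy hyG)).trans_lt hεb
      · simpa [d, indicator_of_notMem hyG] using hε.trans hεb
  obtain ⟨x₁, hx₁, hmax⟩ := husc.exists_isMaxOn ⟨x₀, subset_closure hx₀⟩ hGc
  rw [isMaxOn_iff] at hmax
  have hpos : 0 < d x₁ := by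
    refine lt_of_lt_of_le ?_ (hmax x₀ (subset_closure hx₀))
    rw [hdG x₀ hx₀]
    exact tsub_pos_of_lt hlt
  set δ := d x₁ with hδ
  have hδG : ∀ x, δ ≤ d x → x ∈ G := fun x hx => by
    by_contra hxG
    rw [show d x = 0 from indicator_of_notMem hxG _] at hx
    exact hpos.not_ge hx
  have hδtop : δ ≠ ⊤ := by
    rw [hδ, hdG x₁ (hδG x₁ le_rfl)]
    exact ENNReal.sub_ne_top (hf_top x₁ (hδG x₁ le_rfl))
  have hle : ∀ y ∈ G, f y ≤ w y + δ := fun y hy => by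
    rw [← tsub_le_iff_left, ← hdG y hy]
    exact hmax y (subset_closure hy)
  -- On the maximum set, `w + δ ≤ f ≤ ∫ f ≤ ∫ (w + δ) ≤ w + δ`. Hence `f = w + δ` almost everywhere,
  -- and the measure stays on the maximum set.
  have hempty := hH.eq_empty_of_absorbing h𝒢 hsep (husc.isCompact_inter_preimage_Ici hGc δ)
    (fun x hx => hδG x hx.2) (by
      rintro x ⟨-, hx⟩ W hW
      have hxG := hδG x hx
      have hWi := (h𝒢 x hxG).2 hW
      have := hH.isProbabilityMeasure hWi.1.1 x
      have hfx : w x + δ ≤ f x := by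
        have h1 : δ ≤ f x - w x := hdG x hxG ▸ hx
        have h2 : w x ≤ f x := by
          by_contra! h
          rw [tsub_eq_zero_of_le h.le] at h1
          exact hpos.not_ge h1
        calc w x + δ ≤ w x + (f x - w x) := by gcongr
          _ = f x := add_tsub_cancel_of_le h2
      have hGae := hH.ae_mem_of_mem_insideAt hWi
      have hint : ∫⁻ y, (w y + δ) ∂(H W x) ≤ f x := by
        rw [lintegral_add_right _ measurable_const]
        simp only [lintegral_const, measure_univ, mul_one]
        exact (add_le_add_left (hw.2 x hxG W hW) δ).trans hfx
      have hae : ∀ᵐ y ∂(H W x), f y ≤ w y + δ := by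
        filter_upwards [hGae] with y hy using hle y hy
      have heq := ae_eq_of_ae_le_of_lintegral_le (μ := H W x) (f := f) (g := fun y => w y + δ) hae
        (((lintegral_mono_ae hae).trans hint).trans_lt (hf_top x hxG).lt_top).ne
        ((hH.aemeasurable hWi hw.1).add_const δ) (hint.trans (hf_sub x hxG W hW))
      have : ∀ᵐ y ∂(H W x), y ∈ closure G ∩ d ⁻¹' Ici δ := by
        filter_upwards [heq, hGae] with y hy hyG
        refine ⟨subset_closure hyG, ?_⟩
        have hwy : w y ≠ ⊤ := fun h => hf_top y hyG (by rw [hy, h, top_add])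
        rw [mem_preimage, hdG y hyG, hy, ENNReal.add_sub_cancel_left hwy]
        exact self_mem_Ici
      exact this)
  exact (hempty ▸ (⟨hx₁, le_refl δ⟩ : x₁ ∈ closure G ∩ d ⁻¹' Ici δ) : x₁ ∈ (∅ : Set X))

/-- For continuous `g` between `0` and `w` on `closure V`, the function `H_V g` is continuous,
reproduced by averages inside `V` by `H1`, and equal to `g` on the boundary. Comparison gives `H_V g
≤ w`, and `g` may increase to `w`. Only one family of small sets is tested, which is what makes the
supermean property local. -/
theorem lintegral_le_of_supermeanOn (hH : IsNormalBauerFamily 𝒱 H) {V : Set X} (hV : V ∈ 𝒱)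
    {𝒢 : X → Set (Set X)} (h𝒢 : IsSelection 𝒱 V 𝒢) (hsep : SupermeanSeparates H 𝒢 V)
    {w : X → ENNReal} (hw : SupermeanOn H 𝒢 V w) (hwc : LowerSemicontinuousOn w (closure V)) :
    ∀ x ∈ V, ∫⁻ y, w y ∂(H V x) ≤ w x := by
  classical
  intro x hx
  -- The value `⊤` off `closure V` makes `u` lower semicontinuous on all of `X` and does not affect
  -- the integral, since `H V x` is carried by the boundary.
  let u : X → ENNReal := fun y => if y ∈ closure V then w y else ⊤
  have hu : LowerSemicontinuous u := by
    intro y a ha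
    by_cases hy : y ∈ closure V
    · simp only [u, hy, if_true] at ha
      filter_upwards [eventually_nhdsWithin_iff.1 (hwc y hy a ha)] with z hz
      by_cases hzV : z ∈ closure V
      · simpa only [u, hzV, if_true] using hz hzV
      · simp only [u, hzV, if_false] at ha ⊢
        exact ha.trans_le le_top
    · simp only [u, hy, if_false] at ha
      filter_upwards [isClosed_closure.isOpen_compl.mem_nhds hy] with z hz
      simpa only [u, show z ∉ closure V from hz, if_false] using ha
  have hae : ∀ᵐ y ∂(H V x), w y = u y := by
    filter_upwards [hH.ae_mem_frontier hV hx] with y hy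
    simp only [u, frontier_subset_closure hy, if_true]
  rw [lintegral_congr_ae hae]
  refine lintegral_le_of_forall_continuous hu fun g hg hg0 hgu => ?_
  have hcont := hH.continuous_lintegral_ofReal hV hg hg0
  have hfin : ∀ x, ∫⁻ y, ENNReal.ofReal (g y) ∂(H V x) ≠ ⊤ := fun x => by
    rw [hH.lintegral_ofReal hV x hg hg0]
    exact ENNReal.ofReal_ne_top
  refine hH.le_of_frontier (hH.isOpen hV) (hH.isCompact_closure V hV) h𝒢 hsep hw
    hcont.continuousOn (fun x _ => hfin x) (fun y hy W hW => ?_) (fun z hz ε hε => ?_) x hx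
  · have hWi := (h𝒢 y hy).2 hW
    exact (hH.lintegral_lintegral hV hWi.1.1 (subset_closure.trans hWi.1.2)
      hg.measurable.ennreal_ofReal y).ge
  · have hzV : z ∉ V := by
      rw [(hH.isOpen hV).frontier_eq] at hz
      exact hz.2
    have hzc := frontier_subset_closure hz
    set F : X → ENNReal := fun x => ∫⁻ y, ENNReal.ofReal (g y) ∂(H V x)
    have hFz : F z < w z + ε := by
      have h1 : F z ≤ w z := by
        simp only [F, hH.lintegral_of_notMem hV hzV]
        simpa only [u, hzc, if_true] using hgu z
      by_cases hwz : w z = ⊤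
      · simpa [hwz] using (hfin z).lt_top
      · exact h1.trans_lt (ENNReal.lt_add_right hwz hε.ne')
    obtain ⟨t, hFt, htw⟩ := exists_between hFz
    have hwε : LowerSemicontinuousWithinAt (fun y => w y + ε) (closure V) z :=
      (continuous_add_const ε).continuousAt.comp_lowerSemicontinuousWithinAt
        (hwc z hzc) fun _ _ h => add_le_add_left h ε
    filter_upwards [nhdsWithin_mono z subset_closure (hwε t htw),
      nhdsWithin_le_nhds (hcont.continuousAt.eventually_lt_const hFt)] with y h1 h2
    exact (h2.trans h1).le

/-- `H3` separates points only by functions tested on a local choice. For each `W` inside `V`, the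
members of that choice with closure in `W` suffice to obtain the inequality for `W` itself. -/
theorem supermeanSeparates_of_mem (hH : IsNormalBauerFamily 𝒱 H) {V : Set X} (hV : V ∈ 𝒱) :
    SupermeanSeparates H (insideAt 𝒱 V) V := by
  obtain ⟨𝒲, h𝒲, hsep⟩ := hH.H3 V hV
  have hsep' := hH.supermeanSeparates (fun x hx W hW => (h𝒲 x hx).1 W hW) hsep
  intro x hx y hy hxy
  obtain ⟨s, hs, hne⟩ := hsep' x hx y hy hxy
  refine ⟨s, ⟨hs.1, fun z hz W hW => ?_⟩, hne⟩
  let 𝒢 : X → Set (Set X) := fun y => {W' | W' ∈ 𝒲 y ∧ closure W' ⊆ W}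
  have hWV : W ⊆ V := subset_closure.trans hW.1.2
  have h𝒢 : IsSelection 𝒱 W 𝒢 := fun y hy => by
    refine ⟨?_, fun W' hW' => ⟨⟨((h𝒲 y (hWV hy)).1 W' hW'.1).1.1, hW'.2⟩,
      ((h𝒲 y (hWV hy)).1 W' hW'.1).2⟩⟩
    obtain ⟨C, hC, hCc, hCW⟩ := exists_mem_nhds_isClosed_subset
      ((hH.isOpen hW.1.1).mem_nhds hy)
    obtain ⟨W', hW', hWC⟩ := (h𝒲 y (hWV hy)).2 C hC
    exact ⟨W', hW', (closure_minimal hWC hCc).trans hCW⟩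
  exact hH.lintegral_le_of_supermeanOn hW.1.1 h𝒢 (hsep'.mono hWV fun _ _ _ h => h.1)
    (hs.mono hWV fun _ _ _ h => h.1) (hs.1.mono hW.1.2) z hW.2

/-- The supermean value property is a local property. -/
theorem supermeanOn_of_local (hH : IsNormalBauerFamily 𝒱 H) {U : Set X} {w : X → ENNReal}
    (hw : LowerSemicontinuousOn w U)
    (hloc : ∀ x ∈ U, ∀ N ∈ 𝓝 x, ∃ W ∈ insideAt 𝒱 N x, ∫⁻ y, w y ∂(H W x) ≤ w x) :
    SupermeanOn H (insideAt 𝒱 U) U w := by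
  refine ⟨hw, fun x _ V hV => ?_⟩
  have hVU : V ⊆ U := subset_closure.trans hV.1.2
  let 𝒢 : X → Set (Set X) := fun y => {W | W ∈ insideAt 𝒱 V y ∧ ∫⁻ z, w z ∂(H W y) ≤ w y}
  have h𝒢 : IsSelection 𝒱 V 𝒢 := fun y hy => by
    obtain ⟨W, hW, hle⟩ := hloc y (hVU hy) V ((hH.isOpen hV.1.1).mem_nhds hy)
    exact ⟨⟨W, hW, hle⟩, fun _ h => h.1⟩
  exact hH.lintegral_le_of_supermeanOn hV.1.1 h𝒢
    ((hH.supermeanSeparates_of_mem hV.1.1).mono Subset.rfl fun _ _ _ h => h.1)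
    ⟨hw.mono hVU, fun _ _ _ h => h.2⟩ (hw.mono hV.1.2) x hV.2

end IsNormalBauerFamily

end Bauer

/-! ### Local connectedness and the minimum principle. -/

namespace Bauer

theorem inter_frontier_nonempty {X : Type*} [TopologicalSpace X] {S A : Set X}
    (hS : IsPreconnected S) (h : (S ∩ A).Nonempty) (h' : (S ∩ Aᶜ).Nonempty) :
    (S ∩ frontier A).Nonempty := by
  by_contra! hcon
  have hA : ∀ x ∈ S, x ∈ closure A → x ∈ interior A := fun x hx hxA => by
    by_contra hxi
    exact (hcon ▸ ⟨hx, hxA, hxi⟩ : x ∈ (∅ : Set X))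
  obtain ⟨x, hxS, hxA⟩ := h
  obtain ⟨y, hyS, hyA⟩ := h'
  obtain ⟨z, -, hz, hz'⟩ := hS (interior A) (closure A)ᶜ isOpen_interior
    isClosed_closure.isOpen_compl
    (fun z hz => by
      by_cases h : z ∈ closure A
      · exact Or.inl (hA z hz h)
      · exact Or.inr h)
    ⟨x, hxS, hA x hxS (subset_closure hxA)⟩
    ⟨y, hyS, fun h => hyA (interior_subset (hA y hyS h))⟩
  exact hz' (interior_subset_closure hz)

theorem disjoint_frontier_connectedComponentIn {X : Type*} [TopologicalSpace X]
    [LocallyConnectedSpace X] {U : Set X} (hU : IsOpen U) (x : X) :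
    Disjoint (frontier (connectedComponentIn U x)) U := by
  rw [Set.disjoint_left]
  intro z hz hzU
  have hxU : x ∈ U := by
    by_contra h
    simp [connectedComponentIn_eq_empty h] at hz
  have hC := hU.connectedComponentIn (x := x)
  rw [hC.frontier_eq] at hz
  have hpre : IsPreconnected (insert z (connectedComponentIn U x)) :=
    isPreconnected_connectedComponentIn.subset_closure (subset_insert _ _)
      (insert_subset hz.1 subset_closure)
  exact hz.2 (hpre.subset_connectedComponentIn
    (mem_insert_of_mem _ (mem_connectedComponentIn hxU))
    (insert_subset hzU (connectedComponentIn_subset _ _)) (mem_insert _ _))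

variable {X : Type*} [TopologicalSpace X] [T2Space X] [LocallyCompactSpace X]
  [SecondCountableTopology X] [MeasurableSpace X] [BorelSpace X]
  {𝒱 : Set (Set X)} {H : Set X → Kernel X X}

namespace IsNormalBauerFamily

/-- At points of `O` the bound by `1` is enough, and around other points of `U` small sets do not
see `O`; locality does the rest. Consequently no set inside `U`, however large, transports mass into
`O` from outside `O`. -/
theorem supermeanOn_indicator (hH : IsNormalBauerFamily 𝒱 H) {U O : Set X}
    (hO : IsOpen O) (hUO : IsOpen (U \ O)) :
    SupermeanOn H (insideAt 𝒱 U) U (O.indicator 1) := by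
  refine hH.supermeanOn_of_local
    ((hO.lowerSemicontinuous_indicator zero_le).lowerSemicontinuousOn U) fun x hx N hN => ?_
  by_cases hxO : x ∈ O
  · obtain ⟨W, hW⟩ := hH.exists_mem_insideAt hN
    have := hH.isProbabilityMeasure hW.1.1 x
    refine ⟨W, hW, ?_⟩
    rw [lintegral_indicator_one hO.measurableSet, indicator_of_mem hxO]
    exact prob_le_one
  · obtain ⟨W, hW⟩ := hH.exists_mem_insideAt (inter_mem hN (hUO.mem_nhds ⟨hx, hxO⟩))
    refine ⟨W, insideAt_mono inter_subset_left x hW, ?_⟩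
    rw [lintegral_indicator_one hO.measurableSet]
    have : H W x O = 0 := by
      rw [measure_eq_zero_iff_ae_notMem]
      filter_upwards [hH.ae_mem_of_mem_insideAt hW] with y hy using hy.2.2
    simp [this]

theorem measure_eq_zero_of_isOpen_diff (hH : IsNormalBauerFamily 𝒱 H) {U O W : Set X}
    (hO : IsOpen O) (hUO : IsOpen (U \ O)) {x : X} (hx : x ∉ O) (hW : W ∈ insideAt 𝒱 U x) :
    H W x O = 0 := by
  have h := (hH.supermeanOn_indicator hO hUO).2 x (hW.1.2 (subset_closure hW.2)) W hW
  rwa [lintegral_indicator_one hO.measurableSet, indicator_of_notMem hx, nonpos_iff_eq_zero] at h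

/-- Let `V \ O` be the quasi-component of `x` in `V`, the intersection of all relatively clopen sets
containing `x`. For `W` inside `V`, the function `H W · O` is `0` on `W \ O` and `1` on `W ∩ O`,
since no mass crosses between clopen pieces. By `H4` it is continuous on `W`, so `V \ O` is open. It
is then itself relatively clopen, hence connected. -/
theorem locallyConnectedSpace (hH : IsNormalBauerFamily 𝒱 H) : LocallyConnectedSpace X := by
  rw [locallyConnectedSpace_iff_subsets_isOpen_isConnected]
  intro x N hN
  obtain ⟨V, hV, hxV, hVN⟩ := hH.isBasis.mem_nhds_iff.1 hN
  have hVo := hH.isOpen hV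
  let 𝒜 : Set (Set X) := {A | A ⊆ V ∧ IsOpen A ∧ IsOpen (V \ A) ∧ x ∈ A}
  have hV𝒜 : V ∈ 𝒜 := ⟨Subset.rfl, hVo, by simp, hxV⟩
  let O : Set X := ⋃₀ ((fun A => V \ A) '' 𝒜)
  have hOo : ∀ B ∈ (fun A => V \ A) '' 𝒜, IsOpen B := by
    rintro _ ⟨A, hA, rfl⟩
    exact hA.2.2.1
  have hO : IsOpen O := isOpen_sUnion hOo
  have hVO : V \ O = ⋂₀ 𝒜 := by
    ext y
    simp only [O, Set.mem_sdiff, mem_sUnion, mem_image, exists_exists_and_eq_and, mem_sInter, not_exists,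
      not_and, not_not]
    exact ⟨fun h A hA => h.2 A hA h.1, fun h => ⟨h V hV𝒜, fun A hA _ => h A hA⟩⟩
  have hQ : IsOpen (V \ O) := by
    rw [isOpen_iff_mem_nhds]
    intro y hy
    obtain ⟨W, hW⟩ := hH.exists_mem_insideAt (hVo.mem_nhds hy.1)
    have hWo := hH.isOpen hW.1.1
    have hWV : W ⊆ V := subset_closure.trans hW.1.2
    have hcont := hH.continuousOn_lintegral hW.1.1
      ((measurable_one (α := ENNReal)).indicator hO.measurableSet)
      (fun z => indicator_le_self _ (1 : X → ENNReal) z)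
    simp_rw [lintegral_indicator_one hO.measurableSet] at hcont
    have hy0 : H W y O = 0 := by
      -- `O` is a possibly uncountable union of null sets; a countable subfamily has the same union.
      obtain ⟨T, hT, hTc, hTU⟩ := TopologicalSpace.isOpen_sUnion_countable _ hOo
      rw [show O = ⋃₀ T from hTU.symm, measure_sUnion_null_iff hT]
      intro B hB
      obtain ⟨A, hA, rfl⟩ := hTc hB
      refine hH.measure_eq_zero_of_isOpen_diff hA.2.2.1 ?_ ?_ hW
      · simpa [Set.sdiff_sdiff_right_self, inter_eq_self_of_subset_right hA.1] using hA.2.1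
      · exact fun h => hy.2 ⟨_, ⟨A, hA, rfl⟩, h⟩
    have hlt : ∀ᶠ z in 𝓝 y, H W z O < 1 :=
      (hcont.continuousAt (hWo.mem_nhds hW.2)).eventually_lt_const (by simp [hy0])
    filter_upwards [hlt, hWo.mem_nhds hW.2] with z hz hzW
    refine ⟨hWV hzW, fun hzO => hz.not_ge ?_⟩
    obtain ⟨_, ⟨A, hA, rfl⟩, hzA⟩ := hzO
    have hWz : W ∈ insideAt 𝒱 V z := ⟨hW.1, hzW⟩
    have h0 : H W z A = 0 := hH.measure_eq_zero_of_isOpen_diff hA.2.1 hA.2.2.1 hzA.2 hWz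
    have := hH.isProbabilityMeasure hW.1.1 z
    have h1 : ∀ᵐ t ∂(H W z), t ∈ O := by
      filter_upwards [hH.ae_mem_of_mem_insideAt hWz, measure_eq_zero_iff_ae_notMem.1 h0] with t h1 h2
      exact ⟨_, ⟨A, hA, rfl⟩, h1, h2⟩
    exact ((prob_compl_eq_zero_iff hO.measurableSet).1 h1).ge
  have hxQ : x ∈ V \ O := by
    rw [hVO]
    exact fun A hA => hA.2.2.2
  refine ⟨V \ O, sdiff_subset.trans hVN, hQ, hxQ, ⟨x, hxQ⟩, ?_⟩
  -- The part of a separation containing `x` would be relatively clopen in `V`, hence contains the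
  -- quasi-component.
  have key : ∀ u v : Set X, IsOpen u → IsOpen v → V \ O ⊆ u ∪ v → (V \ O) ∩ (u ∩ v) = ∅ →
      x ∈ u → V \ O ⊆ u := by
    intro u v hu hv huv hdisj hxu
    have : (V \ O) ∩ u ∈ 𝒜 := by
      refine ⟨inter_subset_left.trans sdiff_subset, hQ.inter hu, ?_, hxQ, hxu⟩
      have : V \ ((V \ O) ∩ u) = (O ∩ V) ∪ ((V \ O) ∩ v) := by
        ext y
        constructor
        · rintro ⟨hyV, hy⟩
          by_cases hyO : y ∈ O
          · exact Or.inl ⟨hyO, hyV⟩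
          · exact Or.inr ⟨⟨hyV, hyO⟩, (huv ⟨hyV, hyO⟩).resolve_left fun h => hy ⟨⟨hyV, hyO⟩, h⟩⟩
        · rintro (⟨hyO, hyV⟩ | ⟨hyQ, hyv⟩)
          · exact ⟨hyV, fun h => h.1.2 hyO⟩
          · exact ⟨hyQ.1, fun h => (hdisj ▸ ⟨hyQ, h.2, hyv⟩ : y ∈ (∅ : Set X))⟩
      rw [this]
      exact (hO.inter hVo).union (hQ.inter hv)
    conv_lhs => rw [hVO]
    exact (sInter_subset_of_mem this).trans inter_subset_right
  rw [isPreconnected_iff_subset_of_disjoint]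
  intro u v hu hv huv hdisj
  rcases huv hxQ with hx | hx
  · exact Or.inl (key u v hu hv huv hdisj hx)
  · exact Or.inr (key v u hv hu (by rwa [union_comm]) (by rwa [inter_comm v u]) hx)

/-- Continuity comes for free: near each point `v` coincides with one of its averages, which is
continuous by `H4`. -/
theorem harmonic_toReal (hH : IsNormalBauerFamily 𝒱 H) {U : Set X} (hU : IsOpen U)
    {v : X → ENNReal} (hv : Measurable v) (hv1 : ∀ x, v x ≤ 1)
    (h : ∀ x ∈ U, ∀ W ∈ insideAt 𝒱 U x, ∫⁻ y, v y ∂(H W x) = v x) :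
    Harmonic 𝒱 H U fun x => (v x).toReal := by
  have hfin : ∀ x, v x ≠ ⊤ := fun x => ((hv1 x).trans_lt ENNReal.one_lt_top).ne
  constructor
  · refine ENNReal.continuousOn_toReal.comp (f := v) ?_ fun x _ => hfin x
    intro x hx
    obtain ⟨W, hW⟩ := hH.exists_mem_insideAt (hU.mem_nhds hx)
    have hWo := hH.isOpen hW.1.1
    refine (((hH.continuousOn_lintegral hW.1.1 hv hv1).congr fun y hy => ?_).continuousAt
      (hWo.mem_nhds hW.2)).continuousWithinAt
    exact (h y (hW.1.2 (subset_closure hy)) W ⟨hW.1, hy⟩).symm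
  · intro V hV x hx
    rw [integral_toReal hv.aemeasurable (Eventually.of_forall fun y => (hfin y).lt_top)]
    by_cases hxV : x ∈ V
    · rw [h x hx V ⟨hV, hxV⟩]
    · rw [hH.lintegral_of_notMem hV.1 hxV]

theorem lintegral_le_one (hH : IsNormalBauerFamily 𝒱 H) {V : Set X} (hV : V ∈ 𝒱) (x : X)
    {f : X → ENNReal} (hf1 : ∀ x, f x ≤ 1) : ∫⁻ y, f y ∂(H V x) ≤ 1 := by
  have := hH.isProbabilityMeasure hV x
  calc ∫⁻ y, f y ∂(H V x) ≤ ∫⁻ _, 1 ∂(H V x) := lintegral_mono hf1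
    _ = 1 := by simp

/-- At `z ∉ V` the kernel is a Dirac measure; for a continuous minorant of `f`, the average is
continuous across the boundary of `V` by `H2`. -/
theorem lowerSemicontinuousAt_lintegral (hH : IsNormalBauerFamily 𝒱 H) {V : Set X} (hV : V ∈ 𝒱)
    {f : X → ENNReal} {z : X} (hf : LowerSemicontinuousAt f z) (hz : z ∉ V) :
    LowerSemicontinuousAt (fun x => ∫⁻ y, f y ∂(H V x)) z := by
  intro a ha
  simp only [hH.lintegral_of_notMem hV hz] at ha
  obtain ⟨g, hg, hg0, hgf, hag⟩ := exists_continuous_le_of_lt hf ha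
  have hcont := hH.continuous_lintegral_ofReal hV hg hg0
  rw [← hH.lintegral_of_notMem hV hz fun y => ENNReal.ofReal (g y)] at hag
  filter_upwards [hcont.continuousAt.eventually_const_lt hag] with y hy
  exact hy.trans_le (lintegral_mono hgf)

/-- For an elliptic family, a positive supermean function on a connected open set is identically
zero or strictly positive. -/
theorem eq_zero_or_pos (hH : IsNormalBauerFamily 𝒱 H) (hell : IsElliptic 𝒱 H) {U : Set X}
    (hU : IsOpen U) (hUc : IsPreconnected U) {v : X → ENNReal}
    (hv : SupermeanOn H (insideAt 𝒱 U) U v) :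
    (∀ x ∈ U, v x = 0) ∨ ∀ x ∈ U, 0 < v x := by
  have := hH.locallyConnectedSpace
  by_contra! hcon
  obtain ⟨⟨a, haU, ha⟩, b, hbU, hb⟩ := hcon
  -- `v` need not be harmonic, so ellipticity is applied to `H W · D`, where `D` is a component of
  -- the positivity set and `W` a small neighborhood of a boundary point `x` of `D`, at which `v`
  -- vanishes.
  let G : Set X := {x | x ∈ U ∧ 0 < v x}
  have hG : IsOpen G := by
    rw [isOpen_iff_mem_nhds]
    rintro y ⟨hyU, hy⟩
    filter_upwards [hU.mem_nhds hyU, lowerSemicontinuousAt_of_isOpen hv.1 hU hyU 0 hy]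
      with z h1 h2 using ⟨h1, h2⟩
  have haG : a ∈ G := ⟨haU, pos_iff_ne_zero.2 ha⟩
  set D := connectedComponentIn G a with hD
  have hDo : IsOpen D := hG.connectedComponentIn
  have hDG : D ⊆ G := connectedComponentIn_subset _ _
  have haD : a ∈ D := mem_connectedComponentIn haG
  obtain ⟨x, hxU, hxD⟩ := inter_frontier_nonempty hUc ⟨a, haU, haD⟩
    ⟨b, hbU, fun h => (hDG h).2.not_ge hb⟩
  have hxG : x ∉ G := (disjoint_frontier_connectedComponentIn hG a).notMem_of_mem_left hxD
  have hxa : x ≠ a := fun h => hxG (h ▸ haG)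
  obtain ⟨W, hW⟩ := hH.exists_mem_insideAt
    (inter_mem (hU.mem_nhds hxU) (isOpen_compl_singleton.mem_nhds hxa))
  have hWo := hH.isOpen hW.1.1
  set C := connectedComponentIn W x with hC
  have hCo : IsOpen C := hWo.connectedComponentIn
  have hCW : C ⊆ W := connectedComponentIn_subset _ _
  have hxC : x ∈ C := mem_connectedComponentIn hW.2
  obtain ⟨y, hyC, hyD⟩ := mem_closure_iff.1 (frontier_subset_closure hxD) C hCo hxC
  have haC : a ∉ C := fun h => (hW.1.2 (subset_closure (hCW h))).2 rfl
  -- `D` enters the component `C` of `x` in `W` but also contains `a ∉ C`, so it meets the boundary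
  -- of `C`.
  obtain ⟨z, hzD, hzC⟩ := inter_frontier_nonempty isPreconnected_connectedComponentIn
    ⟨y, hyD, hyC⟩ ⟨a, haD, haC⟩
  have hzW : z ∉ W := (disjoint_frontier_connectedComponentIn hWo x).notMem_of_mem_left hzC
  have hmeas : Measurable fun x => H W x D := Kernel.measurable_coe _ hDo.measurableSet
  have hle : ∀ x, H W x D ≤ 1 := fun x =>
    have := hH.isProbabilityMeasure hW.1.1 x
    prob_le_one
  have hharm : Harmonic 𝒱 H C fun x => (H W x D).toReal := by
    refine hH.harmonic_toReal hCo hmeas hle fun t _ V hV => ?_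
    have := hH.lintegral_lintegral hW.1.1 hV.1.1 ((subset_closure.trans hV.1.2).trans hCW)
      ((measurable_one (α := ENNReal)).indicator hDo.measurableSet) t
    simpa only [lintegral_indicator_one hDo.measurableSet] using this
  have hx0 : H W x D = 0 := by
    have hWi := insideAt_mono (𝒱 := 𝒱) inter_subset_left x hW
    have h0 : ∫⁻ y, v y ∂(H W x) = 0 := by
      have h1 : v x = 0 := by
        by_contra h
        exact hxG ⟨hxU, pos_iff_ne_zero.2 h⟩
      simpa [h1] using hv.2 x hxU W hWi
    rw [lintegral_eq_zero_iff' (hH.aemeasurable hWi hv.1)] at h0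
    rw [measure_eq_zero_iff_ae_notMem]
    filter_upwards [h0] with t ht htD
    exact (hDG htD).2.ne' ht
  have hzero : ∀ t ∈ C, (H W t D).toReal = 0 := by
    rcases hell C hCo ⟨⟨x, hxC⟩, isPreconnected_connectedComponentIn⟩ _ hharm
      fun _ _ => ENNReal.toReal_nonneg with h | h
    · exact h
    · exact absurd (h x hxC) (by simp [hx0])
  -- At `z ∈ D \ W` the function `H W · D` equals `1`; semicontinuity makes it positive at nearby
  -- points of `C`, where it was shown to vanish.
  have hlsc := hH.lowerSemicontinuousAt_lintegral hW.1.1 (f := D.indicator 1) (z := z)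
    ((hDo.lowerSemicontinuous_indicator zero_le) z) hzW 0 (by
      simp [hH.lintegral_of_notMem hW.1.1 hzW, indicator_of_mem (show z ∈ D from hzD)])
  obtain ⟨t, ht, htC⟩ := ((mem_closure_iff_frequently.1 (frontier_subset_closure hzC)).and_eventually
    hlsc).exists
  simp only [lintegral_indicator_one hDo.measurableSet] at htC
  exact htC.ne' (((ENNReal.toReal_eq_zero_iff _).1 (hzero t ht)).resolve_right
    ((hle t).trans_lt ENNReal.one_lt_top).ne)

end IsNormalBauerFamily

end Bauer

/-! ### Balayage of open sets and its boundary behavior. -/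

namespace Bauer

section Balayage

variable {X : Type*} [TopologicalSpace X] [MeasurableSpace X]

/-- Starting from the indicator of `B`, repeatedly take the upper envelope with all averages
with respect to the kernels of sets inside `U`. -/
noncomputable def balayageSeq (𝒱 : Set (Set X)) (H : Set X → Kernel X X) (U B : Set X) :
    ℕ → X → ENNReal
  | 0 => B.indicator 1
  | n + 1 => fun x => balayageSeq 𝒱 H U B n x ⊔
      ⨆ V ∈ inside 𝒱 U, ∫⁻ y, balayageSeq 𝒱 H U B n y ∂(H V x)

/-- The smallest positive supermean function on `U` which is at least `1` on the open set `B`. -/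
noncomputable def balayage (𝒱 : Set (Set X)) (H : Set X → Kernel X X) (U B : Set X) (x : X) :
    ENNReal :=
  ⨆ n, balayageSeq 𝒱 H U B n x

end Balayage

variable {X : Type*} [TopologicalSpace X] [T2Space X] [LocallyCompactSpace X]
  [SecondCountableTopology X] [MeasurableSpace X] [BorelSpace X]
  {𝒱 : Set (Set X)} {H : Set X → Kernel X X} {U B : Set X}

namespace IsNormalBauerFamily

theorem lowerSemicontinuous_lintegral (hH : IsNormalBauerFamily 𝒱 H) {V : Set X} (hV : V ∈ 𝒱)
    {f : X → ENNReal} (hf : LowerSemicontinuous f) (hf1 : ∀ x, f x ≤ 1) :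
    LowerSemicontinuous fun x => ∫⁻ y, f y ∂(H V x) := by
  intro x
  by_cases hx : x ∈ V
  · exact ((hH.continuousOn_lintegral hV hf.measurable hf1).continuousAt
      ((hH.isOpen hV).mem_nhds hx)).lowerSemicontinuousAt
  · exact hH.lowerSemicontinuousAt_lintegral hV (hf x) hx

theorem balayageSeq_le_one (hH : IsNormalBauerFamily 𝒱 H) (n : ℕ) (x : X) :
    balayageSeq 𝒱 H U B n x ≤ 1 := by
  induction n generalizing x with
  | zero => exact indicator_le_self _ (1 : X → ENNReal) x
  | succ n ih => exact sup_le (ih x) (iSup₂_le fun V hV => hH.lintegral_le_one hV.1 x ih)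

theorem balayage_le_one (hH : IsNormalBauerFamily 𝒱 H) (x : X) : balayage 𝒱 H U B x ≤ 1 :=
  iSup_le fun n => hH.balayageSeq_le_one n x

theorem lowerSemicontinuous_balayageSeq (hH : IsNormalBauerFamily 𝒱 H) (hB : IsOpen B) (n : ℕ) :
    LowerSemicontinuous (balayageSeq 𝒱 H U B n) := by
  induction n with
  | zero => exact hB.lowerSemicontinuous_indicator zero_le
  | succ n ih =>
    exact ih.sup (lowerSemicontinuous_biSup fun V hV =>
      hH.lowerSemicontinuous_lintegral hV.1 ih (hH.balayageSeq_le_one n))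

theorem lowerSemicontinuous_balayage (hH : IsNormalBauerFamily 𝒱 H) (hB : IsOpen B) :
    LowerSemicontinuous (balayage 𝒱 H U B) :=
  lowerSemicontinuous_iSup fun n => hH.lowerSemicontinuous_balayageSeq hB n

theorem balayage_eq_one (hH : IsNormalBauerFamily 𝒱 H) {x : X} (hx : x ∈ B) :
    balayage 𝒱 H U B x = 1 := by
  refine (hH.balayage_le_one x).antisymm (le_iSup_of_le 0 ?_)
  simp [balayageSeq, hx]

/-- Countably many iterations suffice: monotone convergence takes the supremum out of the integral,
and every average of one iterate is below the next. -/
theorem supermeanOn_balayage (hH : IsNormalBauerFamily 𝒱 H) (hB : IsOpen B) :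
    SupermeanOn H (insideAt 𝒱 U) U (balayage 𝒱 H U B) := by
  refine ⟨(hH.lowerSemicontinuous_balayage hB).lowerSemicontinuousOn U, fun x _ V hV => ?_⟩
  simp only [balayage]
  rw [lintegral_iSup]
  · refine iSup_le fun n => le_iSup_of_le (n + 1) (le_sup_of_le_right ?_)
    exact le_iSup₂ (f := fun V _ => ∫⁻ y, balayageSeq 𝒱 H U B n y ∂(H V x)) V hV.1
  · exact fun n => (hH.lowerSemicontinuous_balayageSeq hB n).measurable
  · exact monotone_nat_of_le_succ fun n x => le_sup_left

theorem balayage_le (hH : IsNormalBauerFamily 𝒱 H) {w : X → ENNReal}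
    (hw : SupermeanOn H (insideAt 𝒱 U) U w) (hwB : ∀ x ∈ B, 1 ≤ w x) :
    ∀ x ∈ U, balayage 𝒱 H U B x ≤ w x := by
  suffices h : ∀ n, ∀ x ∈ U, balayageSeq 𝒱 H U B n x ≤ w x from
    fun x hx => iSup_le fun n => h n x hx
  intro n
  induction n with
  | zero =>
    intro x _
    by_cases hxB : x ∈ B
    · simpa [balayageSeq, hxB] using hwB x hxB
    · simp [balayageSeq, hxB]
  | succ n ih =>
    refine fun x hx => sup_le (ih x hx) (iSup₂_le fun V hV => ?_)
    by_cases hxV : x ∈ V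
    · refine (lintegral_mono_ae ?_).trans (hw.2 x hx V ⟨hV, hxV⟩)
      filter_upwards [hH.ae_mem_of_mem_insideAt ⟨hV, hxV⟩] with y hy using ih y hy
    · rw [hH.lintegral_of_notMem hV.1 hxV]
      exact ih x hx

/-- Replacing the balayage by its average over `W` yields a supermean function again, still equal to
`1` on `B` because `W` misses `B`. Minimality gives the nontrivial inequality. -/
theorem lintegral_balayage (hH : IsNormalBauerFamily 𝒱 H) (hU : IsOpen U) (hB : IsOpen B)
    {x : X} {W : Set X} (hW : W ∈ insideAt 𝒱 (U \ closure B) x) :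
    ∫⁻ y, balayage 𝒱 H U B y ∂(H W x) = balayage 𝒱 H U B x := by
  have hv := hH.supermeanOn_balayage (U := U) hB
  have hlsc := hH.lowerSemicontinuous_balayage (U := U) hB
  have hxU : x ∈ U := (hW.1.2 (subset_closure hW.2)).1
  have hWU : closure W ⊆ U := hW.1.2.trans sdiff_subset
  refine (hv.2 x hxU W (insideAt_mono sdiff_subset x hW)).antisymm ?_
  refine hH.balayage_le (w := fun x => ∫⁻ y, balayage 𝒱 H U B y ∂(H W x)) ?_ ?_ x hxU
  · refine hH.supermeanOn_of_local ((hH.lowerSemicontinuous_lintegral hW.1.1 hlsc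
      hH.balayage_le_one).lowerSemicontinuousOn U) fun y hy N hN => ?_
    by_cases hyW : y ∈ W
    · obtain ⟨W', hW'⟩ := hH.exists_mem_insideAt
        (inter_mem hN ((hH.isOpen hW.1.1).mem_nhds hyW))
      exact ⟨W', insideAt_mono inter_subset_left y hW', (hH.lintegral_lintegral hW.1.1 hW'.1.1
        (subset_closure.trans (hW'.1.2.trans inter_subset_right)) hlsc.measurable y).le⟩
    · obtain ⟨W', hW'⟩ := hH.exists_mem_insideAt (inter_mem hN (hU.mem_nhds hy))
      refine ⟨W', insideAt_mono inter_subset_left y hW', ?_⟩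
      rw [hH.lintegral_of_notMem hW.1.1 hyW]
      refine (lintegral_mono_ae ?_).trans
        (hv.2 y hy W' (insideAt_mono inter_subset_right y hW'))
      filter_upwards [hH.ae_mem_of_mem_insideAt hW'] with t ht
      by_cases htW : t ∈ W
      · exact hv.2 t ht.2 W ⟨⟨hW.1.1, hWU⟩, htW⟩
      · exact (hH.lintegral_of_notMem hW.1.1 htW _).le
  · intro y hy
    have hyW : y ∉ W := fun h => (hW.1.2 (subset_closure h)).2 (subset_closure hy)
    rw [hH.lintegral_of_notMem hW.1.1 hyW, hH.balayage_eq_one hy]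

theorem harmonic_balayage (hH : IsNormalBauerFamily 𝒱 H) (hU : IsOpen U) (hB : IsOpen B) {G : Set X}
    (hG : IsOpen G) (hGU : G ⊆ U \ closure B) :
    Harmonic 𝒱 H G fun x => (balayage 𝒱 H U B x).toReal :=
  hH.harmonic_toReal hG (hH.lowerSemicontinuous_balayage hB).measurable hH.balayage_le_one
    fun x _ _ hW => hH.lintegral_balayage hU hB (insideAt_mono hGU x hW)

/-- The balayage of an open set `B` tends to zero at each boundary point of `K`, at which there is
a weak barrier, away from `B`. -/
theorem tendsto_balayage (hH : IsNormalBauerFamily 𝒱 H) {W K N : Set X} (hW : IsOpen W)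
    (hK : IsClosed K) {z : X} (hzB : z ∉ closure B) (hN : IsOpen N)
    (hzN : z ∈ N) {s : X → ENNReal} (hs : SupermeanOn H (insideAt 𝒱 (N \ K)) (N \ K) s)
    (hpos : ∀ x ∈ N \ K, 0 < s x) (hlim : Tendsto s (𝓝[N \ K] z) (𝓝 0)) :
    Tendsto (balayage 𝒱 H (W \ K) B) (𝓝[W \ K] z) (𝓝 0) := by
  classical
  rw [ENNReal.tendsto_nhds_zero]
  intro ε hε
  have hNK : IsOpen (N \ K) := hN.sdiff hK
  have hUo : IsOpen (W \ K) := hW.sdiff hK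
  obtain ⟨V, hV⟩ := hH.exists_mem_insideAt (inter_mem (hN.mem_nhds hzN)
    (isClosed_closure.isOpen_compl.mem_nhds hzB))
  have hVo := hH.isOpen hV.1.1
  have hVN : closure V ⊆ N := hV.1.2.trans inter_subset_left
  have hVB : ∀ x ∈ B, x ∉ V := fun x hx h => (hV.1.2 (subset_closure h)).2 (subset_closure hx)
  have := hH.isProbabilityMeasure hV.1.1 z
  -- The barrier is bounded below only on compact parts of `∂V \ K`. The remainder `E`, which may
  -- approach `K`, is chosen with harmonic measure less than `ε / 2` at `z`.
  obtain ⟨F, hFsub, hF, hFε⟩ := (isClosed_frontier (s := V) |>.measurableSet.diff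
    hK.measurableSet).exists_isCompact_sdiff_lt (measure_ne_top (H V z) _)
    (ENNReal.half_pos hε.ne').ne'
  have hFN : F ⊆ N \ K := hFsub.trans
    (sdiff_subset_sdiff_left (frontier_subset_closure.trans hVN))
  set E : Set X := (frontier V \ K) \ F with hE
  have hEm : MeasurableSet E := (isClosed_frontier.measurableSet.diff hK.measurableSet).diff
    hF.measurableSet
  have hEmeas : Measurable fun y => H V y E := Kernel.measurable_coe _ hEm
  have hEcont : ContinuousOn (fun y => H V y E) V := by
    have := hH.continuousOn_lintegral hV.1.1 ((measurable_one (α := ENNReal)).indicator hEm)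
      (fun z => indicator_le_self _ (1 : X → ENNReal) z)
    simpa only [lintegral_indicator_one hEm] using this
  obtain ⟨c, hc, hcF⟩ := exists_forall_one_le_mul hF (hs.1.mono hFN) fun x hx => hpos x (hFN hx)
  have hcs : LowerSemicontinuousOn (fun y => c * s y) (N \ K) :=
    (ENNReal.continuous_const_mul hc).comp_lowerSemicontinuousOn hs.1 fun _ _ h => mul_le_mul' le_rfl h
  -- The majorant: `c * s` is at least `1` on `F`, and `H V · E` supplies boundary values `1` on
  -- `E`. Continuing by `1` outside `V` is therefore compatible with lower semicontinuity, and `w =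
  -- 1` on `B`.
  let w : X → ENNReal := fun y => if y ∈ V then min 1 (H V y E + c * s y) else 1
  have hwV : ∀ y ∈ V, w y = min 1 (H V y E + c * s y) := fun y hy => by simp only [w, hy, if_true]
  have hwnV : ∀ y, y ∉ V → w y = 1 := fun y hy => by simp only [w, hy, if_false]
  have hw1 : ∀ y, w y ≤ 1 := fun y => by
    by_cases hy : y ∈ V
    · exact (hwV y hy).trans_le (min_le_left _ _)
    · exact (hwnV y hy).le
  have hwlsc : LowerSemicontinuousOn w (W \ K) := by
    intro x hx
    refine LowerSemicontinuousAt.lowerSemicontinuousWithinAt _ ?_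
    by_cases hxV : x ∈ V
    · have hxN : x ∈ N \ K := ⟨hVN (subset_closure hxV), hx.2⟩
      have h1 : LowerSemicontinuousAt (fun y => min 1 (H V y E + c * s y)) x :=
        lowerSemicontinuousAt_const.inf
          ((hEcont.continuousAt (hVo.mem_nhds hxV)).lowerSemicontinuousAt.add
            (lowerSemicontinuousAt_of_isOpen hcs hNK hxN))
      intro a ha
      rw [hwV x hxV] at ha
      filter_upwards [h1 a ha, hVo.mem_nhds hxV] with y hy hyV
      rwa [hwV y hyV]
    · intro a ha
      rw [hwnV x hxV] at ha
      by_cases hxcl : x ∈ closure V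
      · have hxN : x ∈ N \ K := ⟨hVN hxcl, hx.2⟩
        suffices h : ∀ᶠ y in 𝓝 x, y ∈ V → a < H V y E + c * s y by
          filter_upwards [h] with y hy
          by_cases hyV : y ∈ V
          · rw [hwV y hyV]
            exact lt_min ha (hy hyV)
          · rwa [hwnV y hyV]
        by_cases hxF : x ∈ F
        · filter_upwards [lowerSemicontinuousAt_of_isOpen hcs hNK hxN a
            (ha.trans_le (hcF x hxF))] with y hy _
          exact hy.trans_le le_add_self
        -- The set `E` need not be open, but for `y ∈ V` the measure `H V y` of the open set `(K ∪
        -- F)ᶜ` is at most that of `E`.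
        · have hO : IsOpen (K ∪ F)ᶜ := (hK.union hF.isClosed).isOpen_compl
          have hxO : x ∈ (K ∪ F)ᶜ := fun h => h.elim hx.2 hxF
          filter_upwards [hH.lowerSemicontinuousAt_lintegral hV.1.1
            (hO.lowerSemicontinuous_indicator (zero_le (a := (1 : ENNReal))) x) hxV a
            (by simpa only [hH.lintegral_of_notMem hV.1.1 hxV, indicator_of_mem hxO] using ha)]
            with y hy hyV
          have hle : H V y (K ∪ F)ᶜ ≤ H V y E := by
            refine measure_mono_ae ?_
            filter_upwards [hH.ae_mem_frontier hV.1.1 hyV] with t ht htO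
            exact ⟨⟨ht, fun h => htO (Or.inl h)⟩, fun h => htO (Or.inr h)⟩
          have hy' : a < H V y (K ∪ F)ᶜ := by
            rw [← lintegral_indicator_one hO.measurableSet]
            exact hy
          exact (hy'.trans_le hle).trans_le le_self_add
      · filter_upwards [isClosed_closure.isOpen_compl.mem_nhds hxcl] with y hy
        rwa [hwnV y fun h => hy (subset_closure h)]
  have hwsuper : SupermeanOn H (insideAt 𝒱 (W \ K)) (W \ K) w := by
    refine hH.supermeanOn_of_local hwlsc fun x hx M hM => ?_
    by_cases hxV : x ∈ V
    · have hxN : x ∈ N \ K := ⟨hVN (subset_closure hxV), hx.2⟩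
      obtain ⟨W', hW'⟩ := hH.exists_mem_insideAt
        (inter_mem hM ((hVo.sdiff hK).mem_nhds ⟨hxV, hx.2⟩))
      refine ⟨W', insideAt_mono inter_subset_left x hW', ?_⟩
      have hW'V : W' ⊆ V :=
        subset_closure.trans (hW'.1.2.trans (inter_subset_right.trans sdiff_subset))
      rw [hwV x hxV]
      refine le_min (hH.lintegral_le_one hW'.1.1 x hw1) ?_
      calc ∫⁻ y, w y ∂(H W' x) ≤ ∫⁻ y, (H V y E + c * s y) ∂(H W' x) := by
            refine lintegral_mono_ae ?_
            filter_upwards [hH.ae_mem_of_mem_insideAt hW'] with y hy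
            rw [hwV y hy.2.1]
            exact min_le_right _ _
        _ = ∫⁻ y, H V y E ∂(H W' x) + c * ∫⁻ y, s y ∂(H W' x) := by
            rw [lintegral_add_left hEmeas, lintegral_const_mul' _ _ hc]
        _ ≤ H V x E + c * s x := by
            gcongr
            · have := hH.lintegral_lintegral hV.1.1 hW'.1.1 hW'V
                ((measurable_one (α := ENNReal)).indicator hEm) x
              simp only [lintegral_indicator_one hEm] at this
              exact this.le
            · refine hs.2 x hxN W' (insideAt_mono ?_ x hW')
              exact inter_subset_right.trans (sdiff_subset_sdiff_left (subset_closure.trans hVN))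
    · obtain ⟨W', hW'⟩ := hH.exists_mem_insideAt hM
      refine ⟨W', hW', ?_⟩
      rw [hwnV x hxV]
      exact hH.lintegral_le_one hW'.1.1 x hw1
  have hle := hH.balayage_le hwsuper fun x hx => (hwnV x (hVB x hx)).ge
  have hlim' : ∀ᶠ y in 𝓝[N \ K] z, c * s y ≤ ε / 2 := by
    have : Tendsto (fun y => c * s y) (𝓝[N \ K] z) (𝓝 0) := by
      simpa using ENNReal.Tendsto.const_mul hlim (Or.inr hc)
    exact ENNReal.tendsto_nhds_zero.1 this _ (ENNReal.half_pos hε.ne')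
  have hEz : ∀ᶠ y in 𝓝 z, H V y E < ε / 2 :=
    (hEcont.continuousAt (hVo.mem_nhds hV.2)).eventually_lt_const hFε
  rw [eventually_nhdsWithin_iff] at hlim' ⊢
  filter_upwards [hlim', hEz, hVo.mem_nhds hV.2] with y h1 h2 hyV hyU
  calc balayage 𝒱 H (W \ K) B y ≤ w y := hle y hyU
    _ ≤ H V y E + c * s y := (hwV y hyV).trans_le (min_le_right _ _)
    _ ≤ ε / 2 + ε / 2 := add_le_add h2.le (h1 ⟨hVN (subset_closure hyV), hyU.2⟩)
    _ = ε := ENNReal.add_halves ε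

end IsNormalBauerFamily

end Bauer

/-! ### Connected components and restriction to smaller sets. -/

namespace Bauer

section Components

variable {X : Type*} [TopologicalSpace X]

theorem isOpen_of_mem_components [LocallyConnectedSpace X] {U V : Set X} (hU : IsOpen U)
    (hV : V ∈ components U) : IsOpen V := by
  obtain ⟨x, -, rfl⟩ := hV
  exact hU.connectedComponentIn

theorem isConnected_of_mem_components {U V : Set X} (hV : V ∈ components U) : IsConnected V := by
  obtain ⟨x, hx, rfl⟩ := hV
  exact isConnected_connectedComponentIn_iff.2 hx

theorem subset_of_mem_components {U V : Set X} (hV : V ∈ components U) : V ⊆ U := by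
  obtain ⟨x, -, rfl⟩ := hV
  exact connectedComponentIn_subset _ _

theorem frontier_subset_of_mem_components [LocallyConnectedSpace X] {W K V : Set X}
    (hU : IsOpen (W \ K)) (hV : V ∈ components (W \ K)) (hVW : closure V ⊆ W) :
    frontier V ⊆ K := by
  obtain ⟨x, -, rfl⟩ := hV
  intro z hz
  by_contra hzK
  exact (disjoint_frontier_connectedComponentIn hU x).notMem_of_mem_left hz
    ⟨hVW (frontier_subset_closure hz), hzK⟩

theorem finite_components_inter [LocallyConnectedSpace X] {U C : Set X} (hU : IsOpen U)
    (hC : IsCompact C) (hCU : C ⊆ U) : {V | V ∈ components U ∧ (V ∩ C).Nonempty}.Finite := by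
  obtain ⟨t, -, ht⟩ := hC.elim_nhds_subcover (connectedComponentIn U) fun x hx =>
    connectedComponentIn_mem_nhds (hU.mem_nhds (hCU hx))
  refine (t.finite_toSet.image (connectedComponentIn U)).subset ?_
  rintro _ ⟨⟨x, -, rfl⟩, y, hyx, hyC⟩
  obtain ⟨a, ha, hya⟩ := mem_iUnion₂.1 (ht hyC)
  exact ⟨a, ha, (connectedComponentIn_eq hya).trans (connectedComponentIn_eq hyx).symm⟩

theorem subset_of_disjoint_frontier {S A : Set X} (hS : IsPreconnected S) (h : (S ∩ A).Nonempty)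
    (hf : ¬ (S ∩ frontier A).Nonempty) : S ⊆ A := by
  intro x hx
  by_contra hxA
  exact hf (inter_frontier_nonempty hS h ⟨x, hx, hxA⟩)

end Components

section Mono

variable {X : Type*} [TopologicalSpace X] [MeasurableSpace X] {𝒱 : Set (Set X)}
  {H : Set X → Kernel X X}

theorem Harmonic.mono {U U' : Set X} {h : X → ℝ} (hh : Harmonic 𝒱 H U h) (hU : U' ⊆ U) :
    Harmonic 𝒱 H U' h :=
  ⟨hh.1.mono hU, fun V hV x hx => hh.2 V ⟨hV.1, hV.2.trans hU⟩ x (hU hx)⟩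

theorem Hyperharmonic.mono {U U' : Set X} {u : X → EReal} (hu : Hyperharmonic 𝒱 H U u)
    (hU : U' ⊆ U) : Hyperharmonic 𝒱 H U' u :=
  ⟨hu.1.mono hU, fun x hx => hu.2.1 x (hU hx),
    fun x hx W hW => hu.2.2 x (hU hx) W ⟨⟨hW.1.1, hW.1.2.trans hU⟩, hW.2⟩⟩

theorem IsPSet.mono {U U' : Set X} (h : IsPSet 𝒱 H U) (hU' : IsOpen U') (hU : U' ⊆ U) :
    IsPSet 𝒱 H U' :=
  ⟨hU', fun x hx y hy hxy =>
    let ⟨u, hu, h0, hne⟩ := h.2 x (hU hx) y (hU hy) hxy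
    ⟨u, Hyperharmonic.mono hu hU, fun z hz => h0 z (hU hz), hne⟩⟩

end Mono

/-! ### Holes and strong stability. -/

variable {X : Type*} [TopologicalSpace X] [T2Space X] [LocallyCompactSpace X]
  [SecondCountableTopology X] [MeasurableSpace X] [BorelSpace X]
  {𝒱 : Set (Set X)} {H : Set X → Kernel X X}

namespace IsNormalBauerFamily

/-- There are no strictly positive harmonic functions with zero boundary values on nonempty
relatively compact open subsets of a `𝒫`-set. -/
theorem eq_empty_of_harmonic (hH : IsNormalBauerFamily 𝒱 H) {P G : Set X} (hP : IsPSet 𝒱 H P)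
    (hG : IsOpen G) (hGP : G ⊆ P) (hGc : IsCompact (closure G)) {h : X → ℝ}
    (hh : Harmonic 𝒱 H G h) (hpos : ∀ x ∈ G, 0 < h x)
    (hlim : ∀ z ∈ frontier G, Tendsto h (𝓝[G] z) (𝓝 0)) : G = ∅ := by
  by_contra hne
  obtain ⟨x, hx⟩ := nonempty_iff_ne_empty.2 hne
  have hle := hH.le_of_frontier hG hGc (𝒢 := insideAt 𝒱 G)
    (fun y hy => ⟨hH.exists_mem_insideAt (hG.mem_nhds hy), Subset.rfl⟩)
    ((hH.supermeanSeparates_of_isPSet hP).mono hGP fun _ _ => insideAt_mono hGP _)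
    (w := 0) ⟨continuous_zero.lowerSemicontinuous.lowerSemicontinuousOn G, by simp⟩
    (f := fun y => ENNReal.ofReal (h y)) (ENNReal.continuous_ofReal.comp_continuousOn hh.1)
    (fun _ _ => ENNReal.ofReal_ne_top) (fun y hy W hW => by
      have hint := hh.2 W hW.1 y hy
      -- The integral of a nonintegrable function is `0` by convention, whereas here it equals `h y
      -- > 0`.
      have hi : Integrable h (H W y) := by
        by_contra hi
        rw [integral_undef hi] at hint
        exact (hpos y hy).ne hint
      rw [← hint, ofReal_integral_eq_lintegral_ofReal hi]
      filter_upwards [hH.ae_mem_of_mem_insideAt hW] with t ht using (hpos t ht).le)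
    (fun z hz ε hε => by
      have : Tendsto (fun y => ENNReal.ofReal (h y)) (𝓝[G] z) (𝓝 0) := by
        simpa using ENNReal.tendsto_ofReal (hlim z hz)
      filter_upwards [ENNReal.tendsto_nhds_zero.1 this ε hε] with y hy
      simpa using hy) x hx
  have : ENNReal.ofReal (h x) = 0 := by simpa using hle
  exact (hpos x hx).not_ge (ENNReal.ofReal_eq_zero.1 this)

theorem harmonic_one (hH : IsNormalBauerFamily 𝒱 H) (U : Set X) :
    Harmonic 𝒱 H U fun _ => 1 := by
  refine ⟨continuousOn_const, fun V hV x _ => ?_⟩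
  have := hH.isProbabilityMeasure hV.1 x
  simp

/-- Otherwise the hole would have empty boundary, and the constant `1` would be a harmonic function
with vacuously zero boundary values. -/
theorem closure_inter_nonempty_of_mem_holes (hH : IsNormalBauerFamily 𝒱 H) {W K V : Set X}
    (hW : IsPSet 𝒱 H W) (hK : IsClosed K) (hV : V ∈ holes W K) : (closure V ∩ K).Nonempty := by
  have := hH.locallyConnectedSpace
  have hU : IsOpen (W \ K) := hW.1.sdiff hK
  by_contra! hemp
  have hfr : frontier V = ∅ := by
    rw [← subset_empty_iff, ← hemp]
    exact subset_inter frontier_subset_closure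
      (frontier_subset_of_mem_components hU hV.1 hV.2.2)
  exact (isConnected_of_mem_components hV.1).nonempty.ne_empty
    (hH.eq_empty_of_harmonic hW (isOpen_of_mem_components hU hV.1)
      (subset_closure.trans hV.2.2) hV.2.1 (hH.harmonic_one V) (fun _ _ => one_pos) (by simp [hfr]))

theorem finite_holes (hH : IsNormalBauerFamily 𝒱 H) {W K : Set X} (hW : IsPSet 𝒱 H W)
    (hKW : K ⊆ W) (hK : IsStronglyStable 𝒱 H K) : (holes W K).Finite := by
  have := hH.locallyConnectedSpace
  obtain ⟨hKc, -, W', hW', hKW', h, hh, hpos, hlim⟩ := hK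
  have hU : IsOpen (W \ K) := hW.1.sdiff hKc.isClosed
  obtain ⟨L, hL, hKL, hLW⟩ := exists_compact_between hKc (hW.1.inter hW'.1)
    (subset_inter hKW hKW')
  have hfrL : frontier L ⊆ W \ K := fun x hx =>
    ⟨(hLW (hL.isClosed.frontier_subset hx)).1, fun hxK => hx.2 (hKL hxK)⟩
  refine (finite_components_inter hU (hL.of_isClosed_subset isClosed_frontier
    hL.isClosed.frontier_subset) hfrL).subset fun V hV => ⟨hV.1, ?_⟩
  by_contra hemp
  have hVconn := isConnected_of_mem_components hV.1
  have hVo := isOpen_of_mem_components hU hV.1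
  have hVU := subset_of_mem_components hV.1
  obtain ⟨z, hzV, hzK⟩ := hH.closure_inter_nonempty_of_mem_holes hW hKc.isClosed hV
  obtain ⟨y, hyL, hyV⟩ := mem_closure_iff.1 hzV _ isOpen_interior (hKL hzK)
  -- `V` reaches the neighborhood `L` of `K` and avoids its boundary, so it cannot leave `L`.
  have hVL : V ⊆ L := subset_of_disjoint_frontier hVconn.isPreconnected
    ⟨y, hyV, interior_subset hyL⟩ hemp
  have hVW' : V ⊆ W' \ K := fun x hx => ⟨(hLW (hVL hx)).2, (hVU hx).2⟩
  refine hVconn.nonempty.ne_empty (hH.eq_empty_of_harmonic hW' hVo (hVW'.trans sdiff_subset)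
    hV.2.1 (hh.mono hVW') (fun x hx => hpos x (hVW' hx)) fun t ht => ?_)
  refine (hlim t ?_).mono_left (nhdsWithin_mono t hVW')
  have htK : t ∈ K := frontier_subset_of_mem_components hU hV.1 hV.2.2 ht
  rw [frontier_eq_closure_inter_closure]
  exact ⟨subset_closure htK, closure_mono (fun x hx => (hVU hx).2) (frontier_subset_closure ht)⟩

theorem isStronglyStable (hH : IsNormalBauerFamily 𝒱 H) (hell : IsElliptic 𝒱 H) {W K : Set X}
    (hW : IsPSet 𝒱 H W) (hKW : K ⊆ W) (hK : IsStable 𝒱 H K) (hne : K.Nonempty)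
    (hfin : (holes W K).Finite) : IsStronglyStable 𝒱 H K := by
  have := hH.locallyConnectedSpace
  have hKc := hK.1
  have hU : IsOpen (W \ K) := hW.1.sdiff hKc.isClosed
  obtain ⟨L, hL, hKL, hLW⟩ := exists_compact_between hKc hW.1 hKW
  have hfrL : frontier L ⊆ W \ K := fun x hx =>
    ⟨hLW (hL.isClosed.frontier_subset hx), fun hxK => hx.2 (hKL hxK)⟩
  set 𝒞 : Set (Set X) := {V | V ∈ components (W \ K) ∧ (V ∩ L).Nonempty}
  have h𝒞 : 𝒞.Finite := by
    refine ((finite_components_inter hU (hL.of_isClosed_subset isClosed_frontier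
      hL.isClosed.frontier_subset) hfrL).union hfin).subset fun V hV => ?_
    by_cases hVL : (V ∩ frontier L).Nonempty
    · exact Or.inl ⟨hV.1, hVL⟩
    · have hsub : closure V ⊆ L := closure_minimal (subset_of_disjoint_frontier
        (isConnected_of_mem_components hV.1).isPreconnected hV.2 hVL) hL.isClosed
      exact Or.inr ⟨hV.1, hL.of_isClosed_subset isClosed_closure hsub, hsub.trans hLW⟩
  have hex : ∀ V ∈ 𝒞, ∃ A, IsOpen A ∧ A.Nonempty ∧ closure A ⊆ V := fun V hV => by
    obtain ⟨x, hx⟩ := (isConnected_of_mem_components hV.1).nonempty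
    obtain ⟨A, hA⟩ := hH.exists_mem_insideAt ((isOpen_of_mem_components hU hV.1).mem_nhds hx)
    exact ⟨A, hH.isOpen hA.1.1, ⟨x, hA.2⟩, hA.1.2⟩
  choose! b hbo hbne hbV using hex
  set B : Set X := ⋃ V ∈ 𝒞, b V
  have hB : IsOpen B := isOpen_biUnion hbo
  -- Finiteness of `𝒞` enters here: the closure of the union is the union of the closures, so `B`
  -- stays away from `K`.
  have hBU : closure B ⊆ W \ K := by
    rw [h𝒞.closure_biUnion]
    exact iUnion₂_subset fun V hV => (hbV V hV).trans (subset_of_mem_components hV.1)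
  have hW'o : IsOpen (interior L \ closure B) := isOpen_interior.sdiff isClosed_closure
  have hW'W : interior L \ closure B ⊆ W := sdiff_subset.trans (interior_subset.trans hLW)
  have hW'U : (interior L \ closure B) \ K ⊆ W \ K := sdiff_subset_sdiff_left hW'W
  -- Removing `closure B` makes the balayage harmonic; staying in `L` ensures that every point lies
  -- in a component containing a piece of `B`.
  refine ⟨hKc, hne, interior L \ closure B, hW.mono hW'o hW'W,
    fun x hx => ⟨hKL hx, fun h => (hBU h).2 hx⟩,
    fun x => (balayage 𝒱 H (W \ K) B x).toReal,
    hH.harmonic_balayage hU hB (hW'o.sdiff hKc.isClosed) fun x hx => ⟨hW'U hx, hx.1.2⟩, ?_, ?_⟩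
  · intro x hx
    have hxU := hW'U hx
    have hV : connectedComponentIn (W \ K) x ∈ 𝒞 :=
      ⟨⟨x, hxU, rfl⟩, x, mem_connectedComponentIn hxU, interior_subset hx.1.1⟩
    have hVU := subset_of_mem_components hV.1
    refine ENNReal.toReal_pos (ne_of_gt ?_)
      ((hH.balayage_le_one x).trans_lt ENNReal.one_lt_top).ne
    rcases hH.eq_zero_or_pos hell (isOpen_of_mem_components hU hV.1)
      isPreconnected_connectedComponentIn ((hH.supermeanOn_balayage hB).mono hVU
        fun _ _ => insideAt_mono hVU _) with h | h
    · obtain ⟨y, hy⟩ := hbne _ hV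
      have h0 := h y (hbV _ hV (subset_closure hy))
      rw [hH.balayage_eq_one (mem_biUnion hV hy)] at h0
      exact absurd h0 one_ne_zero
    · exact h x (mem_connectedComponentIn hxU)
  · intro z hz
    have hzK : z ∈ K := hKc.isClosed.frontier_subset hz
    obtain ⟨N, hN, hzN, s, hs, hspos, hslim⟩ := hK.2.2 z hz
    have hlim := hH.tendsto_balayage (B := B) hW.1 hKc.isClosed
      (fun h => (hBU h).2 hzK) hN hzN
      (hH.supermeanOn_toENNReal (fun _ _ => Subset.rfl) hs.1 fun x hx => (hspos x hx).le)
      (fun x hx => EReal.toENNReal_pos_iff.2 (hspos x hx)) (by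
        simpa [Function.comp_def] using (EReal.continuous_toENNReal.tendsto 0).comp hslim)
    have := (ENNReal.tendsto_toReal ENNReal.zero_ne_top).comp
      (hlim.mono_left (nhdsWithin_mono z hW'U))
    simpa [Function.comp_def] using this

end IsNormalBauerFamily

end Bauer

theorem proposition5p4 {X : Type*} [TopologicalSpace X] [T2Space X] [LocallyCompactSpace X]
    [SecondCountableTopology X] [MeasurableSpace X] [BorelSpace X]
    (𝒱 : Set (Set X)) (H : Set X → Kernel X X)
    (hH : Bauer.IsNormalBauerFamily 𝒱 H) (hell : Bauer.IsElliptic 𝒱 H)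
    (W K : Set X) (hW : Bauer.IsPSet 𝒱 H W) (hKW : K ⊆ W)
    (hK : Bauer.IsStable 𝒱 H K) (hne : K.Nonempty) :
    (Bauer.IsStronglyStable 𝒱 H K ↔ (Bauer.holes W K).Finite) ∧
      ∀ V ∈ Bauer.components (W \ K),
        (IsCompact (closure V) ∧ closure V ⊆ W) ↔ (IsCompact (closure V) ∧ frontier V ⊆ K) := by
  have := hH.locallyConnectedSpace
  have hU : IsOpen (W \ K) := hW.1.sdiff hK.1.isClosed
  refine ⟨⟨fun h => hH.finite_holes hW hKW h, hH.isStronglyStable hell hW hKW hK hne⟩,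
    fun V hV => and_congr_right fun _ =>
      ⟨Bauer.frontier_subset_of_mem_components hU hV, fun h => ?_⟩⟩
  rw [closure_eq_self_union_frontier]
  exact union_subset ((Bauer.subset_of_mem_components hV).trans sdiff_subset) (h.trans hKW)
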